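/- Consider the plant $\dot z=Az+B\psi(Sz)+Nw$, $y=Cz+\eta$, with state $z\in\mathbb R^{n_z}$, disturbance $w\in\mathbb R^{n_w}$, measurement noise $\eta\in\mathbb R^{n_y}$, and $\psi:\mathbb R^{n_q}\to\mathbb R^{n_s}$ satisfying $|\psi(v_1)-\psi(v_2)|\le \ell|v_1-v_2|$ for all $v_1,v_2$, where $\ell>0$. The output is available only at times $t_1<t_2<\cdots$ with $0\le t_1\le T_2$ and $T_1\le t_{k+1}-t_k\le T_2$, where $0<T_1\le T_2$. For gains $L\in\mathbb R^{n_z\times n_y}$, $H\in\mathbb R^{n_y\times n_y}$ consider the observer $$\dot{\hat z}=A\hat z+B\psi(S\hat z)+L\theta,\quad \dot\theta=H\theta\quad(t\ne t_k),\qquad \hat z^+=\hat z,\quad \theta^+=y-C\hat z\quad(t=t_k).$$ Model the interconnection as a hybrid system with state $x=(z,\hat z,\theta,\tau)$, where the timer $\tau\in[0,T_2]$ satisfies $\dot\tau=-1$, and a jump (a sample) occurs exactly when $\tau=0$, after which $\tau^+\in[T_1,T_2]$ is arbitrary. Hybrid arcs $\phi$ are locally absolutely continuous in $t$, hybrid inputs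 $u=(w,\eta)$ are measurable and locally essentially bounded in $t$, and $(\phi,u)$ is a solution pair if they have the same hybrid time domain and satisfy the dynamics. Let $\varepsilon=z-\hat z$, $\tilde\theta=C\varepsilon-\theta$, let $\mathcal A=\{\varepsilon=0,\ \tilde\theta=0,\ \tau\in[0,T_2]\}$, let $|\cdot|_{\mathcal A}$ be the Euclidean distance to $\mathcal A$, and let $y_p=C_p\varepsilon$. Let $\lambda_t,\gamma>0$. Suppose that there are symmetric positive definite $P_1\in\mathbb R^{n_z\times n_z}$, $P_2\in\mathbb R^{n_y\times n_y}$, reals $\delta,\chi>0$ and matrices $J\in\mathbb R^{n_z\times n_y}$, $Y\in\mathbb R^{n_y\times n_y}$ such that, for both $s=1$ and $s=e^{\delta T_2}$, the symmetric matrix $$\begin{pmatrix}\operatorname{He}(P_1A-JC)+2\lambda_tP_1+C_p^{\mathsf T}C_p+\ell^2\chi S^{\mathsf T}S & J+s(A^{\mathsf T}C^{\mathsf T}P_2-C^{\mathsf T}Y) & P_1N & P_1B\\ \bullet & s(\operatorname{He}(Y)+(2\lambda_t-\delta)P_2) & sP_2CN & sP_2CB\\ \bullet&\bullet&-\gamma^2I&0\\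 \bullet&\bullet&\bullet&-\chi I\end{pmatrix}$$ is negative semidefinite, where $\operatorname{He}(M)=M+M^{\mathsf T}$. Let $L=P_1^{-1}J$ and $H=P_2^{-1}Y^{\mathsf T}-CL$. Then: (P1) For $w\equiv0$, $\eta\equiv0$, every maximal solution is complete, and there is $\kappa>0$ with $|\phi(t,j)|_{\mathcal A}\le\kappa e^{-\lambda_t t}|\phi(0,0)|_{\mathcal A}$ for every solution and every $(t,j)$ in its domain. (P2) The system is exponentially input-to-state stable with respect to $\mathcal A$: there are $\kappa,\lambda>0$ and a class-$\mathcal K$ function $\rho$ with $|\phi(t,j)|_{\mathcal A}\le\max\{\kappa e^{-\lambda(t+j)}|\phi(0,0)|_{\mathcal A},\rho(\|u\|_\infty)\}$ for all solution pairs $(\phi,u)$ with $u\in\mathcal L_\infty$ and all $(t,j)\in\operatorname{dom}\phi$; and every maximal solution pair whose input is essentially bounded on bounded portions of its domain is complete. (P3) There is $\alpha>0$ such that every solution pair with $\eta\equiv0$ satisfies $\|y_p\|_2\le\alpha|\phi(0,0)|_{\mathcal A}+\gamma\|w\|_2$, the $\mathcal L_2$ norms being taken over ordinary time in the domain of the solution.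 Moreover, if $Y=0$, the change of variables $(\hat z,\theta)\mapsto(\hat z,v)=(\hat z,\theta+C\hat z)$ transforms the observer into the predictor-based observer $\dot{\hat z}=A\hat z+B\psi(S\hat z)+L(v-C\hat z)$, $\dot v=C(A\hat z+B\psi(S\hat z))$ between the sampling times, $\hat z^+=\hat z$, $v^+=y$ at the sampling times: $(\phi,u)$ is a solution pair of the interconnection with the former if and only if the transformed pair is one of the interconnection with the latter. -/

import Mathlib

open MeasureTheory Set
open scoped ENNReal

noncomputable section

/-! ### Hybrid time domains, hybrid signals, hybrid arcs, hybrid inputs -/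

/-- A hybrid time domain: the union of a finite or infinite sequence of intervals
`[t j, t (j+1)] × {j}` with `t 0 = 0`, where the last interval, if there is one, may also be of
the form `[t J, T)` with `T` finite or infinite. (It always contains `(0, 0)`.) -/
def IsHybridTimeDomain (E : Set (ℝ × ℕ)) : Prop :=
  ∃ t : ℕ → ℝ, t 0 = 0 ∧ Monotone t ∧
    (E = {p | p.1 ∈ Icc (t p.2) (t (p.2 + 1))} ∨
      ∃ (J : ℕ) (last : Set ℝ),
        (last = Icc (t J) (t (J + 1)) ∨
          (t J < t (J + 1) ∧ last = Ico (t J) (t (J + 1))) ∨ last = Ici (t J)) ∧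
        E = {p | (p.2 < J ∧ p.1 ∈ Icc (t p.2) (t (p.2 + 1))) ∨ (p.2 = J ∧ p.1 ∈ last)})

/-- A hybrid signal: a function on a hybrid time domain. Only the values on the domain matter. -/
structure HybridSignal (E : Type*) where
  dom : Set (ℝ × ℕ)
  val : ℝ → ℕ → E
  isDomain : IsHybridTimeDomain dom

namespace HybridSignal

variable {E F : Type*}

/-- The `j`-th time interval `{t | (t, j) ∈ dom}` of a hybrid signal. -/
def slice (φ : HybridSignal E) (j : ℕ) : Set ℝ := {t | (t, j) ∈ φ.dom}

/-- The projection of the domain on ordinary time. -/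
def domT (φ : HybridSignal E) : Set ℝ := {t | ∃ j, (t, j) ∈ φ.dom}

/-- `j(t) = min {j | (t, j) ∈ dom}`. -/
def jmin (φ : HybridSignal E) (t : ℝ) : ℕ := sInf {j | (t, j) ∈ φ.dom}

/-- The composition of a hybrid signal with a map. -/
def map (g : E → F) (φ : HybridSignal E) : HybridSignal F :=
  ⟨φ.dom, fun t j => g (φ.val t j), φ.isDomain⟩

/-- Completeness: the domain is unbounded. -/
def IsComplete (φ : HybridSignal E) : Prop := ∀ M : ℝ, ∃ p ∈ φ.dom, M ≤ p.1 + p.2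

/-- A hybrid arc: locally absolutely continuous in `t` for each `j`. -/
def IsArc [PseudoMetricSpace E] (φ : HybridSignal E) : Prop :=
  ∀ (j : ℕ) (a b : ℝ), a ≤ b → Icc a b ⊆ φ.slice j →
    AbsolutelyContinuousOnInterval (fun t => φ.val t j) a b

/-- A hybrid input: (Lebesgue) measurable and locally essentially bounded in `t` for each `j`. -/
def IsInput [MeasurableSpace E] [Norm E] (u : HybridSignal E) : Prop :=
  ∀ j : ℕ, AEMeasurable (fun t => u.val t j) (volume.restrict (u.slice j)) ∧
    ∀ K ⊆ u.slice j, IsCompact K → ∃ M : ℝ, ∀ᵐ t ∂(volume.restrict K), ‖u.val t j‖ ≤ M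

/-- The `T`-truncated `L∞` norm: the maximum of the essential supremum over the points
of the domain that are not jump points and the supremum over the jump points, `t + j ≤ T`. -/
def truncSupNorm [NormedAddCommGroup E] (u : HybridSignal E) (T : ℝ) : ℝ≥0∞ :=
  max
    (⨆ k : ℕ, essSup (fun s => ‖u.val s k‖ₑ)
      (volume.restrict {s : ℝ | (s, k) ∈ u.dom ∧ (s, k + 1) ∉ u.dom ∧ s + k ≤ T}))
    (⨆ p ∈ {p : ℝ × ℕ | p ∈ u.dom ∧ (p.1, p.2 + 1) ∈ u.dom ∧ p.1 + p.2 ≤ T}, ‖u.val p.1 p.2‖ₑ)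

/-- The `L∞` norm, the limit of the (monotone) truncated norms. -/
def supNorm [NormedAddCommGroup E] (u : HybridSignal E) : ℝ≥0∞ := ⨆ T : ℝ, u.truncSupNorm T

end HybridSignal

/-! ### Hybrid systems with inputs and their solution pairs -/

/-- A hybrid system with state in `X`, flow input in `W` and jump input in `N`. -/
structure HybridSystem (X W N : Type*) where
  flowSet : Set X
  flowMap : X → W → X
  jumpSet : Set X
  jumpMap : X → N → Set X

/-- The space of inputs `u = (w, η)`, with the Euclidean norm of the pair. -/
abbrev InputPair (W N : Type*) := WithLp 2 (W × N)

namespace HybridSystem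

variable {X W N : Type*} [NormedAddCommGroup X] [NormedSpace ℝ X]
  [NormedAddCommGroup W] [MeasurableSpace W]
  [NormedAddCommGroup N] [MeasurableSpace N]

/-- `(φ, u)` is a solution pair: a hybrid arc and a hybrid input with the same domain, which
start in the closure of the flow set or in the jump set and satisfy the flow and jump dynamics. -/
structure IsSolutionPair (H : HybridSystem X W N) (φ : HybridSignal X)
    (u : HybridSignal (InputPair W N)) : Prop where
  arc : φ.IsArc
  input : u.IsInput
  dom_eq : φ.dom = u.dom
  init : φ.val 0 0 ∈ closure H.flowSet ∪ H.jumpSet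
  flow_mem : ∀ j, ∀ t ∈ interior (φ.slice j), φ.val t j ∈ H.flowSet
  flow : ∀ j, ∀ᵐ t ∂(volume.restrict (φ.slice j)),
    HasDerivAt (fun s => φ.val s j) (H.flowMap (φ.val t j) (u.val t j).fst) t
  jump : ∀ t j, (t, j) ∈ φ.dom → (t, j + 1) ∈ φ.dom →
    φ.val t j ∈ H.jumpSet ∧ φ.val t (j + 1) ∈ H.jumpMap (φ.val t j) (u.val t j).snd

/-- `(φ, u)` is a solution pair with input in the class `𝒰` that has no proper extension to
a solution pair with input in `𝒰`. -/
def IsMaximalIn (H : HybridSystem X W N) (𝒰 : Set (HybridSignal (InputPair W N)))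
    (φ : HybridSignal X) (u : HybridSignal (InputPair W N)) : Prop :=
  H.IsSolutionPair φ u ∧ u ∈ 𝒰 ∧
    ∀ φ' u', H.IsSolutionPair φ' u' → u' ∈ 𝒰 → φ.dom ⊆ φ'.dom →
      (∀ t j, (t, j) ∈ φ.dom → φ'.val t j = φ.val t j ∧ u'.val t j = u.val t j) →
      φ'.dom = φ.dom

/-- Inputs that vanish identically. -/
def zeroInputs (W N : Type*) [NormedAddCommGroup W] [NormedAddCommGroup N] :
    Set (HybridSignal (InputPair W N)) :=
  {u | ∀ t j, (t, j) ∈ u.dom → u.val t j = 0}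

/-- Global exponential stability of `𝒜`, for zero inputs, with rate `rate` with respect to
ordinary time: every maximal solution is complete and the distance to `𝒜` decays. -/
def IsGloballyExpStable (H : HybridSystem X W N) (𝒜 : Set X) (rate : ℝ) : Prop :=
  (∀ φ u, H.IsMaximalIn (zeroInputs W N) φ u → φ.IsComplete) ∧
  ∃ κ > 0, ∀ φ u, H.IsSolutionPair φ u → u ∈ zeroInputs W N → ∀ t j, (t, j) ∈ φ.dom →
    Metric.infDist (φ.val t j) 𝒜 ≤ κ * Real.exp (-rate * t) * Metric.infDist (φ.val 0 0) 𝒜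

/-- Exponential input-to-state stability with respect to `𝒜`: a bound by the maximum of an
exponentially decaying term in `t + j` and a class-`𝒦` function of the `L∞` norm of the input, for
all solution pairs with input in `L∞`; and completeness of every maximal solution pair whose input
is essentially bounded on bounded portions of its domain (in particular, is in `L∞`). -/
def IsExpISS (H : HybridSystem X W N) (𝒜 : Set X) : Prop :=
  (∀ φ u, H.IsMaximalIn univ φ u → (∀ T, u.truncSupNorm T < ∞) → φ.IsComplete) ∧
  ∃ κ > 0, ∃ rate > 0, ∃ ρ : ℝ → ℝ,
    ContinuousOn ρ (Ici 0) ∧ StrictMonoOn ρ (Ici 0) ∧ ρ 0 = 0 ∧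
    ∀ φ u, H.IsSolutionPair φ u → u.supNorm < ∞ → ∀ t j, (t, j) ∈ φ.dom →
      Metric.infDist (φ.val t j) 𝒜 ≤
        max (κ * Real.exp (-rate * (t + j)) * Metric.infDist (φ.val 0 0) 𝒜) (ρ u.supNorm.toReal)

/-- `L₂`-external stability, with gain at most `γ`, from the flow input `w` to the output
`h x`, when the jump input `η` vanishes. (Both norms may be infinite.) -/
def IsL2Stable {P : Type*} [NormedAddCommGroup P] (H : HybridSystem X W N) (h : X → P)
    (𝒜 : Set X) (γ : ℝ) : Prop :=
  ∃ α > 0, ∀ φ u, H.IsSolutionPair φ u → (∀ t j, (t, j) ∈ u.dom → (u.val t j).snd = 0) →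
    eLpNorm (fun s => h (φ.val s (φ.jmin s))) 2 (volume.restrict φ.domT) ≤
      ENNReal.ofReal (α * Metric.infDist (φ.val 0 0) 𝒜) +
      ENNReal.ofReal γ *
        eLpNorm (fun s => (u.val s (u.jmin s)).fst) 2 (volume.restrict u.domT)

end HybridSystem

/-! ### The plant, the observer, and their interconnection -/

abbrev Vec (n : ℕ) := EuclideanSpace ℝ (Fin n)

/-- The action of a matrix on Euclidean vectors. -/
abbrev Matrix.act {m n : ℕ} (M : Matrix (Fin m) (Fin n) ℝ) (v : Vec n) : Vec m :=
  Matrix.toEuclideanLin M v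

/-- The data of the plant `ż = A z + B ψ(S z) + N w`, `y = C z + η`, together with the matrix `Cp`
of the performance output `y_p = Cp (z - ẑ)`. -/
structure PlantData (nz ny nw nq ns np : ℕ) where
  A : Matrix (Fin nz) (Fin nz) ℝ
  B : Matrix (Fin nz) (Fin ns) ℝ
  S : Matrix (Fin nq) (Fin nz) ℝ
  N : Matrix (Fin nz) (Fin nw) ℝ
  C : Matrix (Fin ny) (Fin nz) ℝ
  Cp : Matrix (Fin np) (Fin nz) ℝ
  ψ : Vec nq → Vec ns

/-- The state `(z, ẑ, θ, τ)` of the plant, the observer and the sampling timer, with the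
Euclidean norm of `ℝ^(2 nz + ny + 1)`. -/
abbrev ObsState (nz ny : ℕ) := WithLp 2 (Vec nz × WithLp 2 (Vec nz × WithLp 2 (Vec ny × ℝ)))

namespace ObsState

variable {nz ny : ℕ}

def mk (z zhat : Vec nz) (θ : Vec ny) (τ : ℝ) : ObsState nz ny :=
  WithLp.toLp 2 (z, WithLp.toLp 2 (zhat, WithLp.toLp 2 (θ, τ)))

def z (x : ObsState nz ny) : Vec nz := x.fst
def zhat (x : ObsState nz ny) : Vec nz := x.snd.fst
def θ (x : ObsState nz ny) : Vec ny := x.snd.snd.fst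
def τ (x : ObsState nz ny) : ℝ := x.snd.snd.snd

end ObsState

namespace PlantData

variable {nz ny nw nq ns np : ℕ} (p : PlantData nz ny nw nq ns np)

/-- The right-hand side `A z + B ψ(S z)` of the undisturbed plant. -/
def drift (z : Vec nz) : Vec nz := p.A.act z + p.B.act (p.ψ (p.S.act z))

/-- The plant interconnected with the observer
`ẑ' = A ẑ + B ψ(S ẑ) + L θ`, `θ' = H θ` between the sampling times and
`ẑ⁺ = ẑ`, `θ⁺ = y - C ẑ` at the sampling times, where `y = C z + η`. A timer `τ ∈ [0, T₂]`
decreases at unit rate, triggers a sample when it reaches `0`, and is then reset to an arbitrary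
point of `[T₁, T₂]`: the sampling times are exactly the sequences with `0 ≤ t₁ ≤ T₂` and
`T₁ ≤ t_{k+1} - t_k ≤ T₂`. -/
def withObserver (T₁ T₂ : ℝ) (L : Matrix (Fin nz) (Fin ny) ℝ) (H : Matrix (Fin ny) (Fin ny) ℝ) :
    HybridSystem (ObsState nz ny) (Vec nw) (Vec ny) where
  flowSet := {x | x.τ ∈ Icc 0 T₂}
  flowMap x w := ObsState.mk (p.drift x.z + p.N.act w) (p.drift x.zhat + L.act x.θ) (H.act x.θ) (-1)
  jumpSet := {x | x.τ = 0}
  jumpMap x η := {x' | ∃ v ∈ Icc T₁ T₂,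
    x' = ObsState.mk x.z x.zhat ((p.C.act x.z + η) - p.C.act x.zhat) v}

/-- The set where the estimate is exact: `ẑ = z`, `C (z - ẑ) - θ = 0` (that is, `θ = 0`) and
`τ ∈ [0, T₂]`. -/
def target (T₂ : ℝ) : Set (ObsState nz ny) :=
  {x | x.z - x.zhat = 0 ∧ p.C.act (x.z - x.zhat) - x.θ = 0 ∧ x.τ ∈ Icc 0 T₂}

/-- The performance output `y_p = Cp (z - ẑ)`. -/
def perfOutput (x : ObsState nz ny) : Vec np := p.Cp.act (x.z - x.zhat)

/-- The gains `L` and `H` solve the observer design problem with prescribed convergence rate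
`lam` and prescribed `L₂`-gain `γ`. -/
structure SolvesObserverProblem (T₁ T₂ lam γ : ℝ)
    (L : Matrix (Fin nz) (Fin ny) ℝ) (H : Matrix (Fin ny) (Fin ny) ℝ) : Prop where
  /-- Global exponential stability for zero disturbances, with the prescribed rate. -/
  expStable : (p.withObserver T₁ T₂ L H).IsGloballyExpStable (p.target T₂) lam
  /-- Input-to-state stability: the estimation error is bounded for bounded disturbances. -/
  iss : (p.withObserver T₁ T₂ L H).IsExpISS (p.target T₂)
  /-- `L₂`-external stability from `w` to `y_p` for `η = 0`, with the prescribed gain. -/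
  l2 : (p.withObserver T₁ T₂ L H).IsL2Stable p.perfOutput (p.target T₂) γ

/-- The plant interconnected with the predictor-based observer, with state `(z, ẑ, v, τ)`:
`ẑ' = A ẑ + B ψ(S ẑ) + L (v - C ẑ)`, `v' = C (A ẑ + B ψ(S ẑ))` between the sampling times and
`ẑ⁺ = ẑ`, `v⁺ = y` at the sampling times (`v` predicts the output between samples). -/
def withPredictor (T₁ T₂ : ℝ) (L : Matrix (Fin nz) (Fin ny) ℝ) :
    HybridSystem (ObsState nz ny) (Vec nw) (Vec ny) where
  flowSet := {x | x.τ ∈ Icc 0 T₂}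
  flowMap x w := ObsState.mk (p.drift x.z + p.N.act w)
    (p.drift x.zhat + L.act (x.θ - p.C.act x.zhat)) (p.C.act (p.drift x.zhat)) (-1)
  jumpSet := {x | x.τ = 0}
  jumpMap x η := {x' | ∃ v ∈ Icc T₁ T₂, x' = ObsState.mk x.z x.zhat (p.C.act x.z + η) v}

/-- The change of coordinates `(z, ẑ, θ, τ) ↦ (z, ẑ, θ + C ẑ, τ)`. -/
def predictorCoord (x : ObsState nz ny) : ObsState nz ny :=
  ObsState.mk x.z x.zhat (x.θ + p.C.act x.zhat) x.τ

/-- The matrix of the linear matrix inequalities, with `s` in the place of `e^(δ τ)`. Its blocks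
are indexed by the coordinates of `(ε, θ̃)` and `(w, ζ)`. -/
def lmiMatrix (ℓ lam γ δ χ s : ℝ) (P₁ : Matrix (Fin nz) (Fin nz) ℝ)
    (P₂ : Matrix (Fin ny) (Fin ny) ℝ) (J : Matrix (Fin nz) (Fin ny) ℝ)
    (Y : Matrix (Fin ny) (Fin ny) ℝ) :
    Matrix ((Fin nz ⊕ Fin ny) ⊕ (Fin nw ⊕ Fin ns)) ((Fin nz ⊕ Fin ny) ⊕ (Fin nw ⊕ Fin ns)) ℝ :=
  let M₁₁ := (P₁ * p.A - J * p.C) + (P₁ * p.A - J * p.C).transpose + (2 * lam) • P₁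
    + p.Cp.transpose * p.Cp + (ℓ ^ 2 * χ) • (p.S.transpose * p.S)
  let M₁₂ := J + s • (p.A.transpose * p.C.transpose * P₂ - p.C.transpose * Y)
  let M₂₂ := s • (Y + Y.transpose + (2 * lam - δ) • P₂)
  let R := Matrix.fromBlocks (P₁ * p.N) (P₁ * p.B) (s • (P₂ * p.C * p.N)) (s • (P₂ * p.C * p.B))
  Matrix.fromBlocks (Matrix.fromBlocks M₁₁ M₁₂ M₁₂.transpose M₂₂) R R.transpose
    (Matrix.fromBlocks (-(γ ^ 2) • 1) 0 0 (-χ • 1))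

end PlantData

end

/-!
The function `V x = ⟪P₁ ε, ε⟫ + exp (δ τ) ⟪P₂ θ̃, θ̃⟫` is at once a Lyapunov and a storage
function. Along flows `θ̃' = C ε' - θ'` and `τ' = -1`, so that, up to the multiplier
`χ (ℓ² |S ε|² - |ζ|²) ≥ 0` with `ζ = ψ (S z) - ψ (S ẑ)`, `V' + 2 λ V + |y_p|² - γ² |w|²` is a
quadratic form in `(ε, θ̃, w, ζ)`. Its matrix is affine in `s = exp (δ τ)`, hence negative
semidefinite for all `τ ∈ [0, T₂]` as soon as it is so at the endpoints `s = 1` and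
`s = exp (δ T₂)`. A sample keeps `ε` and resets `θ̃` to `-η`, so that `V` grows by at most a
multiple of `|η|²`. Integrating yields the `L₂` bound, and exponential decay in `t`; since samples
are at least `T₁` apart, the latter is also a decay in `t + j`. Maximal solutions are complete
because the flow map is Lipschitz and the timer leaves the flow set only through the jump set, so
that a solution with bounded input on a bounded domain extends.

The predictor-based observer is the image of the observer with `Y = 0`, i.e. `H = -C L`, under the
linear shear `θ ↦ θ + C ẑ`.
-/

noncomputable section

/-! ### Absolutely continuous curves -/

section AbsolutelyContinuous

variable {X Y : Type*} [PseudoMetricSpace X] [PseudoMetricSpace Y] {a b c : ℝ}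

theorem absolutelyContinuousOnInterval_congr {f g : ℝ → X}
    (hf : AbsolutelyContinuousOnInterval f a b) (hfg : EqOn f g (uIcc a b)) :
    AbsolutelyContinuousOnInterval g a b := by
  rw [absolutelyContinuousOnInterval_iff] at hf ⊢
  intro ε hε
  obtain ⟨δ, hδ, h⟩ := hf ε hε
  refine ⟨δ, hδ, fun I hI hlt => ?_⟩
  convert h I hI hlt using 1
  refine Finset.sum_congr rfl fun i hi => ?_
  rw [hfg (hI.1 i hi).1, hfg (hI.1 i hi).2]

theorem absolutelyContinuousOnInterval_comp_lipschitzOnWith {f : ℝ → X} {g : X → Y} {K : NNReal}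
    {s : Set X} (hf : AbsolutelyContinuousOnInterval f a b) (hg : LipschitzOnWith K g s)
    (hs : MapsTo f (uIcc a b) s) : AbsolutelyContinuousOnInterval (fun t => g (f t)) a b := by
  rw [absolutelyContinuousOnInterval_iff] at hf ⊢
  intro ε hε
  obtain ⟨δ, hδ, h⟩ := hf (ε / (K + 1)) (by positivity)
  refine ⟨δ, hδ, fun I hI hlt => ?_⟩
  calc ∑ i ∈ Finset.range I.1, dist (g (f (I.2 i).1)) (g (f (I.2 i).2))
      ≤ ∑ i ∈ Finset.range I.1, K * dist (f (I.2 i).1) (f (I.2 i).2) :=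
        Finset.sum_le_sum fun i hi =>
          hg.dist_le_mul _ (hs (hI.1 i hi).1) _ (hs (hI.1 i hi).2)
    _ ≤ (K + 1) * ∑ i ∈ Finset.range I.1, dist (f (I.2 i).1) (f (I.2 i).2) := by
        rw [← Finset.mul_sum]
        gcongr
        simp
    _ < (K + 1) * (ε / (K + 1)) := by gcongr; exact h I hI hlt
    _ = ε := by field_simp

theorem absolutelyContinuousOnInterval_comp_contDiff {E F : Type*} [NormedAddCommGroup E]
    [NormedSpace ℝ E] [NormedAddCommGroup F] [NormedSpace ℝ F] {f : ℝ → E} {g : E → F}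
    (hf : AbsolutelyContinuousOnInterval f a b) (hg : ContDiff ℝ 1 g) :
    AbsolutelyContinuousOnInterval (fun t => g (f t)) a b := by
  have hcompact : IsCompact (f '' uIcc a b) := isCompact_uIcc.image_of_continuousOn hf.continuousOn
  obtain ⟨K, hK⟩ :=
    hg.locallyLipschitz.locallyLipschitzOn.exists_lipschitzOnWith_of_compact hcompact
  exact absolutelyContinuousOnInterval_comp_lipschitzOnWith hf hK (mapsTo_image _ _)

theorem disjoint_uIoc_of_monotone {m : ℝ → ℝ} (hm : Monotone m) {x y x' y' : ℝ}
    (h : Disjoint (uIoc x y) (uIoc x' y')) :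
    Disjoint (uIoc (m x) (m y)) (uIoc (m x') (m y')) := by
  simp only [uIoc, ← hm.map_min, ← hm.map_max, Ioc_disjoint_Ioc] at h ⊢
  simpa only [hm.map_min, hm.map_max] using hm h

theorem absolutelyContinuousOnInterval_comp_monotone {f : ℝ → X} {m : ℝ → ℝ} {a' b' : ℝ}
    (hf : AbsolutelyContinuousOnInterval f a b) (hmaps : MapsTo m (uIcc a' b') (uIcc a b))
    (hlip : LipschitzWith 1 m) (hm : Monotone m) :
    AbsolutelyContinuousOnInterval (fun t => f (m t)) a' b' := by
  rw [absolutelyContinuousOnInterval_iff] at hf ⊢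
  intro ε hε
  obtain ⟨δ, hδ, h⟩ := hf ε hε
  refine ⟨δ, hδ, fun I hI hlt => ?_⟩
  refine h (I.1, fun i => (m (I.2 i).1, m (I.2 i).2)) ⟨fun i hi => ?_, ?_⟩ ?_
  · exact ⟨hmaps (hI.1 i hi).1, hmaps (hI.1 i hi).2⟩
  · exact fun i hi j hj hij => disjoint_uIoc_of_monotone hm (hI.2 hi hj hij)
  · refine lt_of_le_of_lt (Finset.sum_le_sum fun i _ => ?_) hlt
    simpa only [NNReal.coe_one, one_mul] using hlip.dist_le_mul (I.2 i).1 (I.2 i).2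

theorem absolutelyContinuousOnInterval_ite_le {E : Type*} [NormedAddCommGroup E] [NormedSpace ℝ E]
    {f g : ℝ → E} (hf : AbsolutelyContinuousOnInterval f a b)
    (hg : AbsolutelyContinuousOnInterval g b c) (hab : a ≤ b) (hbc : b ≤ c) (hfg : f b = g b) :
    AbsolutelyContinuousOnInterval (fun t => if t ≤ b then f t else g t) a c := by
  have hleft : AbsolutelyContinuousOnInterval (fun t => f (min t b)) a c := by
    refine absolutelyContinuousOnInterval_comp_monotone hf (fun t ht => ?_)
      (LipschitzWith.id.min_const b) (monotone_id.min monotone_const)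
    rw [uIcc_of_le (hab.trans hbc)] at ht
    rw [uIcc_of_le hab]
    exact ⟨le_min ht.1 hab, min_le_right _ _⟩
  have hright : AbsolutelyContinuousOnInterval (fun t => g (max t b)) a c := by
    refine absolutelyContinuousOnInterval_comp_monotone hg (fun t ht => ?_)
      (LipschitzWith.id.max_const b) (monotone_id.max monotone_const)
    rw [uIcc_of_le (hab.trans hbc)] at ht
    rw [uIcc_of_le hbc]
    exact ⟨le_max_right _ _, max_le ht.2 hbc⟩
  have hconst : AbsolutelyContinuousOnInterval (fun _ : ℝ => f b) a c :=
    contDiffOn_const.absolutelyContinuousOnInterval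
  refine absolutelyContinuousOnInterval_congr ((hleft.add hright).sub hconst) fun t _ => ?_
  by_cases ht : t ≤ b
  · simp [ht, hfg]
  · simp [ht, (not_le.mp ht).le]

theorem le_of_ae_hasDerivAt_nonpos {f : ℝ → ℝ} (hf : AbsolutelyContinuousOnInterval f a b)
    (hab : a ≤ b) (hd : ∀ᵐ t ∂(volume.restrict (Icc a b)), ∃ d ≤ 0, HasDerivAt f d t) :
    f b ≤ f a := by
  have hderiv_le : ∫ x in a..b, deriv f x ≤ 0 := by
    rw [intervalIntegral.integral_of_le hab]
    refine integral_nonpos_of_ae ?_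
    filter_upwards [ae_restrict_of_ae_restrict_of_subset Ioc_subset_Icc_self hd] with t ⟨d, hd, ht⟩
    rwa [ht.deriv]
  linarith [hf.integral_deriv_eq_sub]

/-- The integrating factor `e^{κ t}` reduces the differential inequality to monotonicity. -/
theorem le_exp_mul_of_ae_hasDerivAt_le {f : ℝ → ℝ} {κ : ℝ}
    (hf : AbsolutelyContinuousOnInterval f a b) (hab : a ≤ b)
    (hd : ∀ᵐ t ∂(volume.restrict (Icc a b)), ∃ d ≤ κ * f t, HasDerivAt f d t) :
    f b ≤ Real.exp (κ * (b - a)) * f a := by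
  have hexp : AbsolutelyContinuousOnInterval (fun t => Real.exp (-κ * t)) a b :=
    ContDiff.contDiffOn (by fun_prop) |>.absolutelyContinuousOnInterval
  have hanti : Real.exp (-κ * b) * f b ≤ Real.exp (-κ * a) * f a := by
    refine le_of_ae_hasDerivAt_nonpos (hexp.mul hf) hab ?_
    filter_upwards [hd] with t ⟨d, hd, ht⟩
    have hexp' : HasDerivAt (fun r => Real.exp (-κ * r)) (Real.exp (-κ * t) * -κ) t := by
      simpa using ((hasDerivAt_id t).const_mul (-κ)).exp
    refine ⟨_, ?_, hexp'.mul ht⟩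
    linarith [mul_le_mul_of_nonneg_left hd (Real.exp_pos (-κ * t)).le]
  calc f b = Real.exp (κ * b) * (Real.exp (-κ * b) * f b) := by
        rw [← mul_assoc, ← Real.exp_add]; simp
    _ ≤ Real.exp (κ * b) * (Real.exp (-κ * a) * f a) := by gcongr
    _ = Real.exp (κ * (b - a)) * f a := by rw [← mul_assoc, ← Real.exp_add]; ring_nf

theorem ofReal_add_ofReal_le_of_add_le {y d w : ℝ} (hy : 0 ≤ y) (h : y + d ≤ w) :
    ENNReal.ofReal y + ENNReal.ofReal d ≤ ENNReal.ofReal w + ENNReal.ofReal (-d) := by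
  rcases le_total 0 d with hd | hd
  · rw [← ENNReal.ofReal_add hy hd]
    exact (ENNReal.ofReal_le_ofReal h).trans le_self_add
  · rw [ENNReal.ofReal_of_nonpos hd, add_zero]
    exact (ENNReal.ofReal_le_ofReal (by linarith)).trans ENNReal.ofReal_add_le

theorem ofReal_add_lintegral_le_of_ae_hasDerivAt {f g v : ℝ → ℝ}
    (hac : AbsolutelyContinuousOnInterval v a b) (hab : a ≤ b) (hf : ∀ t, 0 ≤ f t)
    (hv : ∀ t, 0 ≤ v t)
    (hderiv : ∀ᵐ t ∂(volume.restrict (Ioc a b)), ∃ d, f t + d ≤ g t ∧ HasDerivAt v d t) :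
    ENNReal.ofReal (v b) + ∫⁻ t in Ioc a b, ENNReal.ofReal (f t) ≤
      ENNReal.ofReal (v a) + ∫⁻ t in Ioc a b, ENNReal.ofReal (g t) := by
  have hderiv_int : Integrable (deriv v) (volume.restrict (Ioc a b)) :=
    (intervalIntegrable_iff_integrableOn_Ioc_of_le hab).1 hac.intervalIntegrable_deriv
  have hftc := hac.integral_deriv_eq_sub
  rw [intervalIntegral.integral_of_le hab,
    integral_eq_lintegral_pos_part_sub_lintegral_neg_part hderiv_int] at hftc
  set pos := ∫⁻ t in Ioc a b, ENNReal.ofReal (deriv v t) with hpos_def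
  set neg := ∫⁻ t in Ioc a b, ENNReal.ofReal (-deriv v t) with hneg_def
  have hpos : pos ≠ ∞ := hderiv_int.lintegral_lt_top.ne
  have hneg : neg ≠ ∞ := hderiv_int.neg.lintegral_lt_top.ne
  have hmeas : AEMeasurable (fun t => ENNReal.ofReal (-deriv v t)) (volume.restrict (Ioc a b)) :=
    hderiv_int.aemeasurable.neg.ennreal_ofReal
  have hrate : (∫⁻ t in Ioc a b, ENNReal.ofReal (f t)) + pos ≤
      (∫⁻ t in Ioc a b, ENNReal.ofReal (g t)) + neg := by
    rw [hpos_def, hneg_def, ← lintegral_add_right' _ hderiv_int.aemeasurable.ennreal_ofReal,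
      ← lintegral_add_right' _ hmeas]
    refine lintegral_mono_ae ?_
    filter_upwards [hderiv] with t ⟨d, hle, hd⟩
    exact hd.deriv ▸ ofReal_add_ofReal_le_of_add_le (hf t) hle
  have hbalance : ENNReal.ofReal (v b) + neg = ENNReal.ofReal (v a) + pos := by
    rw [← ENNReal.ofReal_toReal hpos, ← ENNReal.ofReal_toReal hneg,
      ← ENNReal.ofReal_add (hv _) ENNReal.toReal_nonneg,
      ← ENNReal.ofReal_add (hv _) ENNReal.toReal_nonneg]
    congr 1
    linarith
  refine (ENNReal.add_le_add_iff_right (ENNReal.add_ne_top.mpr ⟨hpos, hneg⟩)).mp ?_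
  calc _ = (ENNReal.ofReal (v b) + neg) + ((∫⁻ t in Ioc a b, ENNReal.ofReal (f t)) + pos) := by ring
    _ ≤ (ENNReal.ofReal (v a) + pos) + ((∫⁻ t in Ioc a b, ENNReal.ofReal (g t)) + neg) := by
        rw [hbalance]
        gcongr
    _ = _ := by ring

theorem setLIntegral_le_of_forall_Ioc {S : Set ℝ} (hS : S ⊆ Ici 0) {f : ℝ → ℝ≥0∞} {M : ℝ≥0∞}
    (hle : ∀ t ∈ S, ∫⁻ s in Ioc 0 t, f s ≤ M) : ∫⁻ s in S, f s ≤ M := by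
  let U : {q : ℚ // ∃ t ∈ S, (q : ℝ) ≤ t} → Set ℝ := fun q => Ioc 0 (q : ℝ)
  have hdirected : Directed (· ⊆ ·) U := fun q r => by
    rcases le_total q.1 r.1 with hqr | hqr
    · exact ⟨r, Ioc_subset_Ioc_right (by exact_mod_cast hqr), subset_rfl⟩
    · exact ⟨q, subset_rfl, Ioc_subset_Ioc_right (by exact_mod_cast hqr)⟩
  have hU : ∫⁻ s in ⋃ q, U q, f s ≤ M := by
    rw [setLIntegral_iUnion_of_directed f hdirected]
    refine iSup_le fun ⟨q, t, ht, hqt⟩ => ?_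
    exact (lintegral_mono_set (Ioc_subset_Ioc_right hqt)).trans (hle t ht)
  have hnull : volume ({0} ∪ {s | IsGreatest S s}) = 0 := by
    have hsub : {s | IsGreatest S s}.Subsingleton := fun s hs t ht => hs.unique ht
    exact measure_union_null (measure_singleton _) (hsub.measure_zero _)
  refine (lintegral_mono' (Measure.restrict_mono_ae ?_) le_rfl).trans hU
  filter_upwards [measure_eq_zero_iff_ae_notMem.mp hnull] with s hs hsS
  obtain ⟨t, ht, hst⟩ : ∃ t ∈ S, s < t := by
    by_contra! hmax
    exact hs (Or.inr ⟨hsS, hmax⟩)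
  obtain ⟨q, hsq, hqt⟩ := exists_rat_btwn hst
  exact mem_iUnion.mpr
    ⟨⟨q, t, ht, hqt.le⟩, (hS hsS).lt_of_ne fun h => hs (Or.inl h.symm), hsq.le⟩

end AbsolutelyContinuous

section Curves

variable {E : Type*} [NormedAddCommGroup E] [NormedSpace ℝ E] {f : ℝ → E} {a b K : ℝ}

theorem norm_sub_le_of_ae_hasDerivAt {M : ℝ} (hf : AbsolutelyContinuousOnInterval f a b)
    (hab : a ≤ b)
    (hd : ∀ᵐ t ∂(volume.restrict (Icc a b)), ∃ d, ‖d‖ ≤ M ∧ HasDerivAt f d t) :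
    ‖f b - f a‖ ≤ M * (b - a) := by
  obtain ⟨ℓ, hℓ, hℓv⟩ := exists_dual_vector'' ℝ (f b - f a)
  have hℓv : ℓ (f b) - ℓ (f a) = ‖f b - f a‖ := by simpa using hℓv
  have hlin : AbsolutelyContinuousOnInterval (fun t : ℝ => M * t) a b :=
    ContDiff.contDiffOn (by fun_prop) |>.absolutelyContinuousOnInterval
  have hanti : ℓ (f b) - M * b ≤ ℓ (f a) - M * a := by
    refine le_of_ae_hasDerivAt_nonpos
      ((absolutelyContinuousOnInterval_comp_contDiff hf ℓ.contDiff).sub hlin) hab ?_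
    filter_upwards [hd] with t ⟨d, hdM, hd⟩
    refine ⟨ℓ d - M * 1, ?_, (ℓ.hasFDerivAt.comp_hasDerivAt t hd).sub
      ((hasDerivAt_id t).const_mul M)⟩
    linarith [le_abs_self (ℓ d), ℓ.le_of_opNorm_le hℓ d, Real.norm_eq_abs (ℓ d)]
  linarith

theorem deriv_norm_le_norm_deriv {d : E} {e t : ℝ} (hf : HasDerivAt f d t)
    (hnorm : HasDerivAt (fun s => ‖f s‖) e t) : e ≤ ‖d‖ := by
  rw [hasDerivAt_iff_tendsto_slope] at hf hnorm
  refine le_of_tendsto_of_tendsto' hnorm hf.norm fun s => ?_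
  rw [slope_def_module, slope_def_module, norm_smul, smul_eq_mul, Real.norm_eq_abs]
  exact (le_abs_self _).trans (by rw [abs_mul]; gcongr; exact abs_norm_sub_norm_le _ _)

theorem one_add_norm_le_of_ae_hasDerivAt (hf : AbsolutelyContinuousOnInterval f a b) (hab : a ≤ b)
    (hd : ∀ᵐ t ∂(volume.restrict (Icc a b)), ∃ d, ‖d‖ ≤ K * (1 + ‖f t‖) ∧ HasDerivAt f d t) :
    1 + ‖f b‖ ≤ Real.exp (K * (b - a)) * (1 + ‖f a‖) := by
  have hnorm : AbsolutelyContinuousOnInterval (fun t => ‖f t‖) a b :=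
    absolutelyContinuousOnInterval_comp_lipschitzOnWith hf
      (lipschitzWith_one_norm.lipschitzOnWith (s := univ)) (mapsTo_univ _ _)
  have hone : AbsolutelyContinuousOnInterval (fun _ : ℝ => (1 : ℝ)) a b :=
    contDiffOn_const.absolutelyContinuousOnInterval
  refine le_exp_mul_of_ae_hasDerivAt_le (hone.add hnorm) hab ?_
  filter_upwards [hd, ae_restrict_of_ae hnorm.ae_differentiableAt,
    ae_restrict_mem measurableSet_Icc] with t ⟨d, hdK, hd⟩ hdiff ht
  have hderiv := (hdiff (Icc_subset_uIcc ht)).hasDerivAt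
  exact ⟨_, (deriv_norm_le_norm_deriv hd hderiv).trans hdK, hderiv.const_add 1⟩

theorem lipschitzOnWith_Ico_of_ae_hasDerivAt {M : ℝ}
    (hf : ∀ s t, a ≤ s → s ≤ t → t < b → AbsolutelyContinuousOnInterval f s t)
    (hd : ∀ᵐ t ∂(volume.restrict (Ico a b)), ∃ d, ‖d‖ ≤ M ∧ HasDerivAt f d t) :
    LipschitzOnWith M.toNNReal f (Ico a b) := by
  have hle : ∀ s ∈ Ico a b, ∀ t ∈ Ico a b, s ≤ t → dist (f t) (f s) ≤ M.toNNReal * dist t s := by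
    intro s hs t ht hst
    have hsub : Icc s t ⊆ Ico a b := fun r hr => ⟨hs.1.trans hr.1, hr.2.trans_lt ht.2⟩
    rw [dist_eq_norm, Real.dist_eq, abs_of_nonneg (sub_nonneg.2 hst)]
    refine (norm_sub_le_of_ae_hasDerivAt (hf s t hs.1 hst ht.2) hst
      (ae_restrict_of_ae_restrict_of_subset hsub hd)).trans ?_
    exact mul_le_mul_of_nonneg_right (Real.le_coe_toNNReal M) (sub_nonneg.2 hst)
  refine LipschitzOnWith.of_dist_le_mul fun s hs t ht => ?_
  rcases le_total t s with hts | hst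
  · exact hle t ht s hs hts
  · simpa only [dist_comm] using hle s hs t ht hst

theorem exists_lipschitzWith_eqOn_Ico [FiniteDimensional ℝ E] (hK : 0 ≤ K)
    (hf : ∀ s t, a ≤ s → s ≤ t → t < b → AbsolutelyContinuousOnInterval f s t)
    (hd : ∀ᵐ t ∂(volume.restrict (Ico a b)), ∃ d, ‖d‖ ≤ K * (1 + ‖f t‖) ∧ HasDerivAt f d t) :
    ∃ (C : NNReal) (g : ℝ → E), LipschitzWith C g ∧ EqOn f g (Ico a b) := by
  set R : ℝ := Real.exp (K * (b - a)) * (1 + ‖f a‖)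
  have hR : ∀ t ∈ Ico a b, 1 + ‖f t‖ ≤ R := fun t ht => by
    refine (one_add_norm_le_of_ae_hasDerivAt (hf a t le_rfl ht.1 ht.2) ht.1
      (ae_restrict_of_ae_restrict_of_subset (Icc_subset_Ico_right ht.2) hd)).trans ?_
    exact mul_le_mul_of_nonneg_right
      (Real.exp_le_exp.2 (mul_le_mul_of_nonneg_left (by linarith [ht.2]) hK)) (by positivity)
  have hlip : LipschitzOnWith (K * R).toNNReal f (Ico a b) := by
    refine lipschitzOnWith_Ico_of_ae_hasDerivAt hf ?_
    filter_upwards [hd, ae_restrict_mem measurableSet_Ico] with t ⟨d, hdK, hd⟩ ht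
    exact ⟨d, hdK.trans (mul_le_mul_of_nonneg_left (hR t ht) hK), hd⟩
  obtain ⟨g, hg, hfg⟩ := hlip.extend_finite_dimension
  exact ⟨_, g, hg, hfg⟩

theorem absolutelyContinuousOnInterval_of_hasDerivAt {f' : ℝ → E}
    (hd : ∀ t ∈ uIcc a b, HasDerivAt f (f' t) t) (hf' : ContinuousOn f' (uIcc a b)) :
    AbsolutelyContinuousOnInterval f a b := by
  obtain ⟨M, hM⟩ := isCompact_uIcc.exists_bound_of_continuousOn hf'
  refine LipschitzOnWith.absolutelyContinuousOnInterval (K := M.toNNReal) ?_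
  refine (convex_uIcc a b).lipschitzOnWith_of_nnnorm_hasDerivWithin_le
    (fun t ht => (hd t ht).hasDerivWithinAt) fun t ht => ?_
  rw [← norm_toNNReal]
  exact Real.toNNReal_le_toNNReal (hM t ht)

end Curves

section PicardLindelof

variable {E : Type*} [NormedAddCommGroup E]

theorem exists_isPicardLindelof_of_lipschitzWith {F : E → E} {C : NNReal}
    (hF : LipschitzWith C F) (x₀ : E) (t₀ : ℝ) :
    ∃ (ε : ℝ) (hε : 0 < ε) (L : NNReal), IsPicardLindelof (fun _ => F) (tmin := t₀ - ε)
      (tmax := t₀ + ε) ⟨t₀, by linarith, by linarith⟩ x₀ 1 0 L C := by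
  have hpos : (0 : ℝ) < ‖F x₀‖₊ + C + 1 := by positivity
  refine ⟨1 / (‖F x₀‖₊ + C + 1), by positivity, ‖F x₀‖₊ + C,
    IsPicardLindelof.of_time_independent (fun x hx => ?_) hF.lipschitzOnWith ?_⟩
  · have hdist : ‖F x - F x₀‖ ≤ C * 1 := by
      rw [← dist_eq_norm]
      exact (hF.dist_le_mul x x₀).trans (by gcongr; simpa using hx)
    push_cast
    linarith [norm_le_norm_add_norm_sub' (F x) (F x₀)]
  · simp only [add_sub_cancel_left, sub_sub_cancel, max_self, NNReal.coe_one, NNReal.coe_zero,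
      sub_zero, NNReal.coe_add]
    rw [mul_one_div, div_le_one hpos]
    linarith

theorem exists_forall_mem_Ioo_hasDerivAt_of_lipschitzWith [NormedSpace ℝ E] [CompleteSpace E]
    {F : E → E} {C : NNReal} (hF : LipschitzWith C F) (x₀ : E) (t₀ : ℝ) :
    ∃ α : ℝ → E, α t₀ = x₀ ∧ ∃ ε > 0, ∀ t ∈ Ioo (t₀ - ε) (t₀ + ε), HasDerivAt α (F (α t)) t := by
  obtain ⟨ε, hε, L, hPL⟩ := exists_isPicardLindelof_of_lipschitzWith hF x₀ t₀
  obtain ⟨α, hα₀, hα⟩ := hPL.exists_eq_forall_mem_Icc_hasDerivWithinAt₀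
  exact ⟨α, hα₀, ε, hε, fun t ht =>
    (hα t (Ioo_subset_Icc_self ht)).hasDerivAt (Icc_mem_nhds ht.1 ht.2)⟩

end PicardLindelof

/-! ### Hybrid time domains -/

/-- The hybrid time domain with jump times `t 1, …, t J` and last slice `S`, the general form of a
hybrid time domain with finitely many jumps. -/
def truncatedTimeDomain (t : ℕ → ℝ) (J : ℕ) (S : Set ℝ) : Set (ℝ × ℕ) :=
  {p | (p.2 < J ∧ p.1 ∈ Icc (t p.2) (t (p.2 + 1))) ∨ (p.2 = J ∧ p.1 ∈ S)}

section Truncated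

variable {t : ℕ → ℝ} {r : ℝ} {j J : ℕ} {S : Set ℝ}

theorem mem_truncatedTimeDomain_of_lt (hj : j < J) :
    (r, j) ∈ truncatedTimeDomain t J S ↔ r ∈ Icc (t j) (t (j + 1)) := by
  simp [truncatedTimeDomain, hj, hj.ne]

theorem mem_truncatedTimeDomain_self : (r, J) ∈ truncatedTimeDomain t J S ↔ r ∈ S := by
  simp [truncatedTimeDomain]

theorem le_of_mem_truncatedTimeDomain (h : (r, j) ∈ truncatedTimeDomain t J S) : j ≤ J :=
  h.elim (fun h => h.1.le) fun h => h.1.le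

theorem truncatedTimeDomain_union_prod (S' : Set ℝ) :
    truncatedTimeDomain t J S ∪ S' ×ˢ {J} = truncatedTimeDomain t J (S ∪ S') := by
  ext ⟨s, i⟩
  simp only [truncatedTimeDomain, mem_union, mem_ofPred_eq, mem_prod, mem_singleton_iff]
  tauto

theorem truncatedTimeDomain_union_singleton (c : ℝ) :
    truncatedTimeDomain t J (Icc (t J) (t (J + 1))) ∪ {(c, J + 1)} =
      truncatedTimeDomain t (J + 1) {c} := by
  ext ⟨s, i⟩
  simp only [truncatedTimeDomain, mem_union, mem_ofPred_eq, mem_singleton_iff, Prod.mk.injEq,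
    Nat.lt_succ_iff_lt_or_eq]
  constructor
  · rintro ((h | ⟨rfl, h⟩) | h) <;> tauto
  · rintro (⟨h | rfl, h'⟩ | h) <;> tauto

theorem isHybridTimeDomain_truncatedTimeDomain_Icc {c : ℝ} (h0 : t 0 = 0) (ht : Monotone t)
    (hc : t (J + 1) = c) : IsHybridTimeDomain (truncatedTimeDomain t J (Icc (t J) c)) :=
  ⟨t, h0, ht, Or.inr ⟨J, _, Or.inl (by rw [hc]), rfl⟩⟩

end Truncated

namespace IsHybridTimeDomain

variable {D : Set (ℝ × ℕ)} {r s t a b c : ℝ} {i j J : ℕ}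

/-- The two shapes of a hybrid time domain: infinitely many jumps, or finitely many. -/
theorem eq_or_eq_truncatedTimeDomain (hD : IsHybridTimeDomain D) :
    ∃ t : ℕ → ℝ, t 0 = 0 ∧ Monotone t ∧ (D = {p | p.1 ∈ Icc (t p.2) (t (p.2 + 1))} ∨
      ∃ (J : ℕ) (S : Set ℝ), IsLeast S (t J) ∧ S.OrdConnected ∧ D = truncatedTimeDomain t J S) := by
  obtain ⟨t, h0, hmono, hall | ⟨J, S, hS, hD⟩⟩ := hD
  · exact ⟨t, h0, hmono, Or.inl hall⟩
  · refine ⟨t, h0, hmono, Or.inr ⟨J, S, ?_⟩⟩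
    rcases hS with rfl | ⟨hlt, rfl⟩ | rfl
    · exact ⟨isLeast_Icc (hmono J.le_succ), ordConnected_Icc, hD⟩
    · exact ⟨isLeast_Ico hlt, ordConnected_Ico, hD⟩
    · exact ⟨isLeast_Ici, ordConnected_Ici, hD⟩

theorem isLeast_zero (hD : IsHybridTimeDomain D) : IsLeast {r | (r, 0) ∈ D} 0 := by
  obtain ⟨t, h0, hmono, rfl | ⟨J, S, hS, -, rfl⟩⟩ := hD.eq_or_eq_truncatedTimeDomain
  · simpa only [← h0] using! isLeast_Icc (hmono (Nat.zero_le 1))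
  · rcases J.eq_zero_or_pos with rfl | hJ
    · simpa only [mem_truncatedTimeDomain_self, h0] using! hS
    · simpa only [mem_truncatedTimeDomain_of_lt hJ, h0] using! isLeast_Icc (hmono (Nat.zero_le 1))

theorem zero_mem (hD : IsHybridTimeDomain D) : ((0 : ℝ), 0) ∈ D := hD.isLeast_zero.1

theorem ordConnected (hD : IsHybridTimeDomain D) (j : ℕ) : OrdConnected {t : ℝ | (t, j) ∈ D} := by
  obtain ⟨t, -, -, rfl | ⟨J, S, -, hS, rfl⟩⟩ := hD.eq_or_eq_truncatedTimeDomain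
  · exact (ordConnected_Icc : OrdConnected (Icc (t j) (t (j + 1))))
  · rcases lt_trichotomy j J with hj | rfl | hj
    · simpa only [mem_truncatedTimeDomain_of_lt hj] using! ordConnected_Icc
    · simpa only [mem_truncatedTimeDomain_self] using! hS
    · have hempty : {t' : ℝ | (t', j) ∈ truncatedTimeDomain t J S} = ∅ :=
        eq_empty_of_forall_notMem fun _ h => hj.not_ge (le_of_mem_truncatedTimeDomain h)
      exact hempty ▸ ordConnected_empty

theorem exists_isGreatest_isLeast (hD : IsHybridTimeDomain D) (ht : (t, j + 1) ∈ D) :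
    ∃ s, IsGreatest {r | (r, j) ∈ D} s ∧ IsLeast {r | (r, j + 1) ∈ D} s := by
  obtain ⟨T, -, hmono, rfl | ⟨J, S, hS, -, rfl⟩⟩ := hD.eq_or_eq_truncatedTimeDomain
  · exact ⟨T (j + 1), isGreatest_Icc (hmono j.le_succ), isLeast_Icc (hmono (j + 1).le_succ)⟩
  · have hjJ : j + 1 ≤ J := le_of_mem_truncatedTimeDomain ht
    refine ⟨T (j + 1), ?_, ?_⟩
    · simpa only [mem_truncatedTimeDomain_of_lt hjJ] using! isGreatest_Icc (hmono j.le_succ)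
    · rcases hjJ.eq_or_lt with rfl | hlt
      · simpa only [mem_truncatedTimeDomain_self] using! hS
      · simpa only [mem_truncatedTimeDomain_of_lt hlt] using! isLeast_Icc (hmono (j + 1).le_succ)

theorem nonneg (hD : IsHybridTimeDomain D) (ht : (t, j) ∈ D) : 0 ≤ t := by
  induction j generalizing t with
  | zero => exact hD.isLeast_zero.2 ht
  | succ j ih =>
    obtain ⟨s, hs, hs'⟩ := hD.exists_isGreatest_isLeast ht
    exact (ih hs.1).trans (hs'.2 ht)

theorem induction (hD : IsHybridTimeDomain D) {P : ℝ → ℕ → Prop} (zero : P 0 0)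
    (flow : ∀ j a b, a ≤ b → (a, j) ∈ D → (b, j) ∈ D → P a j → P b j)
    (jump : ∀ t j, (t, j) ∈ D → (t, j + 1) ∈ D → P t j → P t (j + 1)) (ht : (t, j) ∈ D) :
    P t j := by
  induction j generalizing t with
  | zero => exact flow 0 0 t (hD.nonneg ht) hD.zero_mem ht zero
  | succ j ih =>
    obtain ⟨s, hs, hs'⟩ := hD.exists_isGreatest_isLeast ht
    exact flow (j + 1) s t (hs'.2 ht) hs'.1 ht (jump s j hs.1 hs'.1 (ih hs.1))

theorem le_of_lt (hD : IsHybridTimeDomain D) (hs : (s, i) ∈ D) (ht : (t, j) ∈ D) (hij : i < j) :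
    s ≤ t := by
  induction j generalizing t with
  | zero => omega
  | succ j ih =>
    obtain ⟨r, hr, hr'⟩ := hD.exists_isGreatest_isLeast ht
    rcases Nat.lt_succ_iff_lt_or_eq.mp hij with hlt | rfl
    · exact (ih hr.1 hlt).trans (hr'.2 ht)
    · exact (hr.2 hs).trans (hr'.2 ht)

theorem mem_of_subset (hD : IsHybridTimeDomain D) {D' : Set (ℝ × ℕ)} (hD' : IsHybridTimeDomain D')
    (hsub : D ⊆ D') (ht : (t, j + 1) ∈ D) (ht' : (t, j) ∈ D') : (t, j) ∈ D := by
  obtain ⟨s, hs, hs'⟩ := hD.exists_isGreatest_isLeast ht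
  obtain ⟨r, hr, hr'⟩ := hD'.exists_isGreatest_isLeast (hsub ht)
  obtain rfl : t = s := le_antisymm ((hr.2 ht').trans (hr'.2 (hsub hs'.1))) (hs'.2 ht)
  exact hs.1

theorem exists_mem_of_le (hD : IsHybridTimeDomain D) (ht : (t, j) ∈ D) (hs : 0 ≤ s)
    (hst : s ≤ t) : ∃ i, (s, i) ∈ D := by
  refine hD.induction (P := fun t _ => ∀ s, 0 ≤ s → s ≤ t → ∃ i, (s, i) ∈ D) ?_ ?_
    (fun _ _ _ _ h => h) ht s hs hst
  · intro s hs hs'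
    exact ⟨0, by rw [le_antisymm hs' hs]; exact hD.zero_mem⟩
  · intro j a b _ ha hb h s hs hsb
    rcases le_total s a with hsa | has
    · exact h s hs hsa
    · exact ⟨j, (hD.ordConnected j).out ha hb ⟨has, hsb⟩⟩

theorem exists_last_slice (hD : IsHybridTimeDomain D) (hbdd : ¬ ∀ M : ℝ, ∃ p ∈ D, M ≤ p.1 + p.2) :
    ∃ (J : ℕ) (a b : ℝ), (∀ j t, (t, j) ∈ D → j ≤ J) ∧
      ((a ≤ b ∧ {t | (t, J) ∈ D} = Icc a b) ∨ (a < b ∧ {t | (t, J) ∈ D} = Ico a b)) := by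
  have hmem : ∀ r j, (r, j) ∈ D → 0 ≤ r := fun _ _ h => hD.nonneg h
  obtain ⟨t, -, hmono, rfl | ⟨J, S, hS, rfl⟩⟩ := hD
  · refine absurd (fun M => ?_) hbdd
    obtain ⟨n, hn⟩ := exists_nat_ge M
    have hn' : (t n, n) ∈ {p : ℝ × ℕ | p.1 ∈ Icc (t p.2) (t (p.2 + 1))} := ⟨le_rfl, hmono n.le_succ⟩
    exact ⟨_, hn', hn.trans (le_add_of_nonneg_left (hmem _ _ hn'))⟩
  · change ∃ (J' : ℕ) (a b : ℝ), (∀ j r, (r, j) ∈ truncatedTimeDomain t J S → j ≤ J') ∧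
      ((a ≤ b ∧ {r | (r, J') ∈ truncatedTimeDomain t J S} = Icc a b) ∨
        (a < b ∧ {r | (r, J') ∈ truncatedTimeDomain t J S} = Ico a b))
    refine ⟨J, t J, t (J + 1), fun _ _ => le_of_mem_truncatedTimeDomain, ?_⟩
    simp only [mem_truncatedTimeDomain_self, ofPred_mem_eq]
    rcases hS with rfl | ⟨hlt, rfl⟩ | rfl
    · exact Or.inl ⟨hmono J.le_succ, rfl⟩
    · exact Or.inr ⟨hlt, rfl⟩
    · refine absurd hbdd (not_not_intro fun M =>
        ⟨(max M (t J), J), Or.inr ⟨rfl, mem_Ici.2 (le_max_right _ _)⟩, ?_⟩)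
      exact (le_max_left M (t J)).trans (le_add_of_nonneg_right J.cast_nonneg)

/-- Stopping the jump times after `J` normalizes a bounded last slice to `[t J, t (J + 1)]`. -/
theorem exists_union_eq_truncatedTimeDomain (hD : IsHybridTimeDomain D)
    (hlast : ∀ j t, (t, j) ∈ D → j ≤ J) (ha : (a, J) ∈ D)
    (hc : ∀ r, (r, J) ∈ D → r ≤ c) :
    ∃ t : ℕ → ℝ, t 0 = 0 ∧ Monotone t ∧ (∀ n > J, t n = c) ∧
      D ∪ Icc a c ×ˢ {J} = truncatedTimeDomain t J (Icc (t J) c) := by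
  obtain ⟨T, h0, hmono, rfl | ⟨J', S, hS, hord, rfl⟩⟩ := hD.eq_or_eq_truncatedTimeDomain
  · exact absurd (hlast (J + 1) (T (J + 1)) ⟨le_rfl, hmono (J + 1).le_succ⟩) (by omega)
  obtain rfl : J' = J :=
    (hlast J' (T J') (mem_truncatedTimeDomain_self.2 hS.1)).antisymm
      (le_of_mem_truncatedTimeDomain ha)
  simp only [mem_truncatedTimeDomain_self] at ha hc
  have hTc : T J' ≤ c := hc _ hS.1
  have hSc : S ∪ Icc a c = Icc (T J') c := by
    refine Subset.antisymm (union_subset (fun r hr => ⟨hS.2 hr, hc r hr⟩)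
      (Icc_subset_Icc_left (hS.2 ha))) fun r hr => ?_
    exact (le_total r a).imp (fun hra => hord.out hS.1 ha ⟨hr.1, hra⟩) fun har => ⟨har, hr.2⟩
  refine ⟨fun n => if n ≤ J' then T n else c, by simp [h0], fun m n hmn => ?_,
    fun n hn => if_neg (by omega), ?_⟩
  · rcases le_or_gt n J' with hn | hn
    · simpa only [hmn.trans hn, hn, if_true] using hmono hmn
    · simp only [hn.not_ge, if_false]
      split_ifs with hm
      exacts [(hmono hm).trans hTc, le_rfl]
  · rw [truncatedTimeDomain_union_prod, hSc]
    ext ⟨s, i⟩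
    simp only [truncatedTimeDomain, mem_ofPred_eq]
    refine or_congr (and_congr_right fun hi => ?_) (and_congr_right fun _ => ?_)
    · rw [if_pos hi.le, if_pos (Nat.succ_le_of_lt hi)]
    · rw [if_pos le_rfl]

theorem union_Icc_prod (hD : IsHybridTimeDomain D) (hlast : ∀ j t, (t, j) ∈ D → j ≤ J)
    (ha : (a, J) ∈ D) (hc : ∀ r, (r, J) ∈ D → r ≤ c) :
    IsHybridTimeDomain (D ∪ Icc a c ×ˢ {J}) := by
  obtain ⟨t, h0, hmono, htc, hDt⟩ := hD.exists_union_eq_truncatedTimeDomain hlast ha hc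
  exact hDt ▸ isHybridTimeDomain_truncatedTimeDomain_Icc h0 hmono (htc _ J.lt_succ_self)

theorem union_singleton (hD : IsHybridTimeDomain D) (hlast : ∀ j t, (t, j) ∈ D → j ≤ J)
    (hb : IsGreatest {r | (r, J) ∈ D} b) : IsHybridTimeDomain (D ∪ {(b, J + 1)}) := by
  obtain ⟨t, h0, hmono, htb, hDt⟩ :=
    hD.exists_union_eq_truncatedTimeDomain hlast hb.1 hb.2
  have hDb : D ∪ Icc b b ×ˢ {J} = D := by
    rw [Icc_self, singleton_prod_singleton, union_eq_left, singleton_subset_iff]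
    exact hb.1
  rw [hDb, ← htb _ J.lt_succ_self] at hDt
  rw [hDt, truncatedTimeDomain_union_singleton]
  have := isHybridTimeDomain_truncatedTimeDomain_Icc h0 hmono (htb (J + 2) (by omega))
  simpa only [htb _ J.lt_succ_self, Icc_self] using! this

end IsHybridTimeDomain

/-! ### Hybrid signals -/

namespace HybridSignal

section Slices

variable {E : Type*} (φ : HybridSignal E) {a b s t κ : ℝ} {j : ℕ}

theorem Icc_subset_slice (ha : (a, j) ∈ φ.dom) (hb : (b, j) ∈ φ.dom) : Icc a b ⊆ φ.slice j :=
  (φ.isDomain.ordConnected j).out ha hb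

theorem measurableSet_slice (j : ℕ) : MeasurableSet (φ.slice j) :=
  (φ.isDomain.ordConnected j).measurableSet

theorem ae_mem_interior_slice (j : ℕ) :
    ∀ᵐ t ∂(volume.restrict (φ.slice j)), t ∈ interior (φ.slice j) := by
  have hfrontier : volume (frontier (φ.slice j)) = 0 :=
    (φ.isDomain.ordConnected j).convex.addHaar_frontier volume
  rw [ae_restrict_iff' (φ.measurableSet_slice j)]
  filter_upwards [measure_eq_zero_iff_ae_notMem.mp hfrontier] with t ht hts
  by_contra hnotMem
  exact ht ⟨subset_closure hts, hnotMem⟩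

theorem jmin_eq (ha : (a, j) ∈ φ.dom) (hs : (s, j) ∈ φ.dom) (has : a < s) : φ.jmin s = j := by
  refine le_antisymm (Nat.sInf_le hs) ?_
  by_contra! hlt
  exact has.not_ge (φ.isDomain.le_of_lt (Nat.sInf_mem (s := {i | (s, i) ∈ φ.dom}) ⟨j, hs⟩) ha hlt)

theorem le_exp_mul_of_flow_of_jump {g : ℝ → ℕ → ℝ}
    (hac : ∀ j s t, s ≤ t → Icc s t ⊆ φ.slice j →
      AbsolutelyContinuousOnInterval (fun r => g r j) s t)
    (hflow : ∀ j, ∀ᵐ t ∂(volume.restrict (φ.slice j)),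
      ∃ d ≤ κ * g t j, HasDerivAt (fun r => g r j) d t)
    (hjump : ∀ t j, (t, j) ∈ φ.dom → (t, j + 1) ∈ φ.dom → g t (j + 1) ≤ g t j)
    (ht : (t, j) ∈ φ.dom) : g t j ≤ Real.exp (κ * t) * g 0 0 := by
  refine φ.isDomain.induction (P := fun t j => g t j ≤ Real.exp (κ * t) * g 0 0) (by simp)
    (fun j a b hab ha hb h => ?_) (fun t j ht ht' h => (hjump t j ht ht').trans h) ht
  have hsub := φ.Icc_subset_slice ha hb
  calc g b j ≤ Real.exp (κ * (b - a)) * g a j :=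
        le_exp_mul_of_ae_hasDerivAt_le (hac j a b hab hsub) hab
          (ae_restrict_of_ae_restrict_of_subset hsub (hflow j))
    _ ≤ Real.exp (κ * (b - a)) * (Real.exp (κ * a) * g 0 0) := by gcongr
    _ = Real.exp (κ * b) * g 0 0 := by rw [← mul_assoc, ← Real.exp_add]; ring_nf

theorem lintegral_domT_le_of_flow_of_jump {f g v : ℝ → ℕ → ℝ} (hf : ∀ t j, 0 ≤ f t j)
    (hv : ∀ t j, 0 ≤ v t j)
    (hac : ∀ j s t, s ≤ t → Icc s t ⊆ φ.slice j →
      AbsolutelyContinuousOnInterval (fun r => v r j) s t)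
    (hflow : ∀ j, ∀ᵐ t ∂(volume.restrict (φ.slice j)),
      ∃ d, f t j + d ≤ g t j ∧ HasDerivAt (fun r => v r j) d t)
    (hjump : ∀ t j, (t, j) ∈ φ.dom → (t, j + 1) ∈ φ.dom → v t (j + 1) ≤ v t j) :
    ∫⁻ t in φ.domT, ENNReal.ofReal (f t (φ.jmin t)) ≤
      ENNReal.ofReal (v 0 0) + ∫⁻ t in φ.domT, ENNReal.ofReal (g t (φ.jmin t)) := by
  set F : ℝ → ℝ≥0∞ := fun t => ENNReal.ofReal (f t (φ.jmin t))
  set G : ℝ → ℝ≥0∞ := fun t => ENNReal.ofReal (g t (φ.jmin t))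
  have hsplit : ∀ (k : ℝ → ℝ≥0∞) {a b : ℝ}, 0 ≤ a → a ≤ b →
      ∫⁻ s in Ioc 0 b, k s = (∫⁻ s in Ioc 0 a, k s) + ∫⁻ s in Ioc a b, k s := fun k a b ha hab => by
    rw [← Ioc_union_Ioc_eq_Ioc ha hab,
      lintegral_union measurableSet_Ioc (Ioc_disjoint_Ioc_of_le le_rfl)]
  have hdissip : ∀ {t : ℝ} {j : ℕ}, (t, j) ∈ φ.dom →
      ENNReal.ofReal (v t j) + ∫⁻ s in Ioc 0 t, F s ≤
        ENNReal.ofReal (v 0 0) + ∫⁻ s in Ioc 0 t, G s := fun {t j} ht => by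
    refine φ.isDomain.induction (P := fun t j => ENNReal.ofReal (v t j) + ∫⁻ s in Ioc 0 t, F s ≤
      ENNReal.ofReal (v 0 0) + ∫⁻ s in Ioc 0 t, G s) (by simp) (fun j a b hab ha hb h => ?_)
      (fun t j ht ht' h => le_trans (by gcongr; exact hjump t j ht ht') h) ht
    have hsub := φ.Icc_subset_slice ha hb
    have hstep : ENNReal.ofReal (v b j) + ∫⁻ s in Ioc a b, F s ≤
        ENNReal.ofReal (v a j) + ∫⁻ s in Ioc a b, G s := by
      refine ofReal_add_lintegral_le_of_ae_hasDerivAt (hac j a b hab hsub) hab (fun _ => hf _ _)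
        (fun _ => hv _ j) ?_
      filter_upwards [ae_restrict_of_ae_restrict_of_subset (Ioc_subset_Icc_self.trans hsub)
        (hflow j), ae_restrict_mem measurableSet_Ioc] with t ht htab
      rwa [φ.jmin_eq ha (hsub (Ioc_subset_Icc_self htab)) htab.1]
    rw [hsplit F (φ.isDomain.nonneg ha) hab, hsplit G (φ.isDomain.nonneg ha) hab, ← add_assoc]
    calc _ = ENNReal.ofReal (v b j) + (∫⁻ s in Ioc a b, F s) + ∫⁻ s in Ioc 0 a, F s := by ring
      _ ≤ ENNReal.ofReal (v a j) + (∫⁻ s in Ioc a b, G s) + ∫⁻ s in Ioc 0 a, F s := by gcongr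
      _ = ENNReal.ofReal (v a j) + (∫⁻ s in Ioc 0 a, F s) + ∫⁻ s in Ioc a b, G s := by ring
      _ ≤ _ := by rw [← add_assoc]; gcongr
  refine setLIntegral_le_of_forall_Ioc (S := φ.domT) (fun t ⟨_, ht⟩ => φ.isDomain.nonneg ht)
    fun t ⟨j, ht⟩ => ?_
  refine le_add_self.trans ((hdissip ht).trans ?_)
  gcongr
  exact fun s hs => φ.isDomain.exists_mem_of_le ht hs.1.le hs.2

end Slices

section SupNorm

variable {E : Type*} [NormedAddCommGroup E] (u : HybridSignal E) {t T : ℝ} {j : ℕ}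

theorem enorm_le_truncSupNorm (ht : (t, j) ∈ u.dom) (ht' : (t, j + 1) ∈ u.dom) (hT : t + j ≤ T) :
    ‖u.val t j‖ₑ ≤ u.truncSupNorm T :=
  (le_iSup₂ (f := fun (p : ℝ × ℕ) (_ : p ∈ {p : ℝ × ℕ | p ∈ u.dom ∧
    (p.1, p.2 + 1) ∈ u.dom ∧ p.1 + p.2 ≤ T}) => ‖u.val p.1 p.2‖ₑ) (t, j) ⟨ht, ht', hT⟩).trans
    (le_max_right _ _)

theorem ae_enorm_le_truncSupNorm (j : ℕ) (T : ℝ) :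
    ∀ᵐ t ∂(volume.restrict (u.slice j)), t + j ≤ T → ‖u.val t j‖ₑ ≤ u.truncSupNorm T := by
  set S : ℕ → Set ℝ := fun k => {s : ℝ | (s, k) ∈ u.dom ∧ (s, k + 1) ∉ u.dom ∧ s + k ≤ T}
  have hT : MeasurableSet {s : ℝ | s + j ≤ T} := measurableSet_le (by fun_prop) measurable_const
  have hS : MeasurableSet (S j) :=
    (u.measurableSet_slice j).inter ((u.measurableSet_slice (j + 1)).compl.inter hT)
  have hflow := ENNReal.ae_le_essSup (μ := volume.restrict (S j)) fun s => ‖u.val s j‖ₑ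
  rw [ae_restrict_iff' hS] at hflow
  rw [ae_restrict_iff' (u.measurableSet_slice j)]
  filter_upwards [hflow] with t ht htj hT
  by_cases htj' : (t, j + 1) ∈ u.dom
  · exact u.enorm_le_truncSupNorm htj htj' hT
  · exact (ht ⟨htj, htj', hT⟩).trans ((le_iSup (fun k => essSup (fun s => ‖u.val s k‖ₑ)
      (volume.restrict (S k))) j).trans (le_max_left _ _))

/-- The flow values of the input are essentially bounded by `r` and its values at the jump points
are bounded by `r`; this is what a bound on the `L∞` norm says pointwise. -/
structure IsBoundedBy (u : HybridSignal E) (r : ℝ) : Prop where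
  ae_norm_le : ∀ j, ∀ᵐ t ∂(volume.restrict (u.slice j)), ‖u.val t j‖ ≤ r
  norm_le : ∀ t j, (t, j) ∈ u.dom → (t, j + 1) ∈ u.dom → ‖u.val t j‖ ≤ r

theorem isBoundedBy_supNorm (hu : u.supNorm < ∞) : u.IsBoundedBy u.supNorm.toReal := by
  refine ⟨fun j => ?_, fun t j ht ht' => ?_⟩
  · have htrunc : ∀ᵐ t ∂(volume.restrict (u.slice j)), ∀ n : ℕ,
        t + j ≤ (n : ℝ) → ‖u.val t j‖ₑ ≤ u.truncSupNorm (n : ℝ) :=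
      ae_all_iff.mpr fun n => u.ae_enorm_le_truncSupNorm j n
    filter_upwards [htrunc] with t ht
    obtain ⟨n, hn⟩ := exists_nat_ge (t + j)
    rw [← toReal_enorm]
    exact ENNReal.toReal_mono hu.ne ((ht n hn).trans (le_iSup u.truncSupNorm (n : ℝ)))
  · rw [← toReal_enorm]
    exact ENNReal.toReal_mono hu.ne ((u.enorm_le_truncSupNorm ht ht' le_rfl).trans (le_iSup _ _))

end SupNorm

section Extension

variable {E : Type*} [NormedAddCommGroup E] {u : HybridSignal E} {D : Set (ℝ × ℕ)}

open Classical in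
/-- The extension of a hybrid input to a larger hybrid time domain by zero. -/
def extendZero (u : HybridSignal E) (D : Set (ℝ × ℕ)) (hD : IsHybridTimeDomain D) :
    HybridSignal E :=
  ⟨D, fun t j => if (t, j) ∈ u.dom then u.val t j else 0, hD⟩

theorem extendZero_val_of_mem (hD : IsHybridTimeDomain D) {t : ℝ} {j : ℕ} (ht : (t, j) ∈ u.dom) :
    (u.extendZero D hD).val t j = u.val t j :=
  if_pos ht

theorem extendZero_val_of_notMem (hD : IsHybridTimeDomain D) {t : ℝ} {j : ℕ}
    (ht : (t, j) ∉ u.dom) : (u.extendZero D hD).val t j = 0 :=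
  if_neg ht

/-- Essential boundedness on bounded portions of each flow interval. Unlike the local boundedness
of a hybrid input this reaches up to a missing right end point, so that the input can be continued
past it. -/
def IsBoundedOnBoundedTimes (u : HybridSignal E) : Prop :=
  ∀ (j : ℕ) (T : ℝ), ∃ M : ℝ, ∀ᵐ t ∂(volume.restrict (u.slice j)), t ≤ T → ‖u.val t j‖ ≤ M

theorem isBoundedOnBoundedTimes_of_truncSupNorm_lt_top (hu : ∀ T, u.truncSupNorm T < ∞) :
    u.IsBoundedOnBoundedTimes := by
  refine fun j T => ⟨(u.truncSupNorm (T + j)).toReal, ?_⟩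
  filter_upwards [u.ae_enorm_le_truncSupNorm j (T + j)] with t ht htT
  rw [← toReal_enorm]
  exact ENNReal.toReal_mono (hu _).ne (ht (by linarith))

theorem IsInput.extendZero [MeasurableSpace E] (hu : u.IsInput) (hb : u.IsBoundedOnBoundedTimes)
    (hD : IsHybridTimeDomain D) : (u.extendZero D hD).IsInput := by
  classical
  refine fun j => ⟨?_, fun K _ hK => ?_⟩
  · have hmeas : AEMeasurable ((u.slice j).indicator fun t => u.val t j) volume :=
      (aemeasurable_indicator_iff (u.measurableSet_slice j)).mpr (hu j).1
    refine hmeas.restrict.congr (Filter.Eventually.of_forall fun t => ?_)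
    exact indicator_apply _ _ t
  · obtain ⟨T, hT⟩ := hK.bddAbove
    obtain ⟨M, hM⟩ := hb j T
    rw [ae_restrict_iff' (u.measurableSet_slice j)] at hM
    refine ⟨max M 0, ?_⟩
    rw [ae_restrict_iff' hK.measurableSet]
    filter_upwards [hM] with t ht htK
    by_cases htj : (t, j) ∈ u.dom
    · rw [extendZero_val_of_mem hD htj]
      exact (ht htj (hT htK)).trans (le_max_left _ _)
    · rw [extendZero_val_of_notMem hD htj, norm_zero]
      exact le_max_right _ _

end Extension

end HybridSignal

namespace HybridSystem

variable {W N : Type*} [NormedAddCommGroup W] [NormedAddCommGroup N]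
  {u : HybridSignal (InputPair W N)}

theorem isBoundedBy_zero_of_mem_zeroInputs (hu : u ∈ zeroInputs W N) : u.IsBoundedBy 0 := by
  refine ⟨fun j => ?_, fun t j ht _ => by rw [hu t j ht, norm_zero]⟩
  filter_upwards [ae_restrict_mem (u.measurableSet_slice j)] with t ht
  rw [hu t j ht, norm_zero]

theorem isBoundedOnBoundedTimes_of_mem_zeroInputs (hu : u ∈ zeroInputs W N) :
    u.IsBoundedOnBoundedTimes := by
  refine fun j T => ⟨0, ?_⟩
  filter_upwards [(isBoundedBy_zero_of_mem_zeroInputs hu).ae_norm_le j] with t ht _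
  exact ht

theorem extendZero_mem_zeroInputs (hu : u ∈ zeroInputs W N) {D : Set (ℝ × ℕ)}
    (hD : IsHybridTimeDomain D) : u.extendZero D hD ∈ zeroInputs W N := by
  intro t j _
  by_cases htj : (t, j) ∈ u.dom
  · rw [HybridSignal.extendZero_val_of_mem hD htj, hu t j htj]
  · exact HybridSignal.extendZero_val_of_notMem hD htj

end HybridSystem

/-! ### Extension of solution pairs -/

namespace HybridSignal

/-- The signal obtained by enlarging the domain to `D` and replacing the `k`-th flow piece by `g`:
the elementary step by which a solution is continued. -/
def updateSlice {E : Type*} (φ : HybridSignal E) (D : Set (ℝ × ℕ)) (hD : IsHybridTimeDomain D)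
    (k : ℕ) (g : ℝ → E) : HybridSignal E :=
  ⟨D, fun t => Function.update (φ.val t) k (g t), hD⟩

section UpdateSlice

variable {E : Type*} {φ : HybridSignal E} {D : Set (ℝ × ℕ)} {hD : IsHybridTimeDomain D} {k j : ℕ}
  {g : ℝ → E} {t : ℝ}

theorem updateSlice_val_self : (φ.updateSlice D hD k g).val t k = g t :=
  Function.update_self _ _ _

theorem updateSlice_val_of_ne (hj : j ≠ k) : (φ.updateSlice D hD k g).val t j = φ.val t j :=
  Function.update_of_ne hj _ _

theorem updateSlice_val_of_mem (hval : EqOn g (fun t => φ.val t k) (φ.slice k))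
    (ht : (t, j) ∈ φ.dom) : (φ.updateSlice D hD k g).val t j = φ.val t j := by
  rcases eq_or_ne j k with rfl | hj
  · exact updateSlice_val_self.trans (hval ht)
  · exact updateSlice_val_of_ne hj

end UpdateSlice

end HybridSignal

namespace HybridSystem

variable {X W N : Type*} [NormedAddCommGroup X] [NormedSpace ℝ X]
  [NormedAddCommGroup W] [MeasurableSpace W] [NormedAddCommGroup N] [MeasurableSpace N]
  {S : HybridSystem X W N} {φ : HybridSignal X} {u : HybridSignal (InputPair W N)}
  {D : Set (ℝ × ℕ)} {hD : IsHybridTimeDomain D} {J k : ℕ} {g : ℝ → X} {a b c : ℝ}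

open HybridSignal

theorem IsSolutionPair.slice_eq (h : S.IsSolutionPair φ u) (j : ℕ) : φ.slice j = u.slice j := by
  rw [slice, slice, h.dom_eq]

theorem IsSolutionPair.updateSlice_flow (h : S.IsSolutionPair φ u) (hsub : φ.dom ⊆ D)
    (hval : EqOn g (fun t => φ.val t k) (φ.slice k))
    (hslice : ∀ j ≠ k, ∀ t, (t, j) ∈ D → (t, j) ∈ φ.dom)
    (hflow : ∀ᵐ t ∂(volume.restrict ({t | (t, k) ∈ D} \ φ.slice k)),
      HasDerivAt g (S.flowMap (g t) 0) t) (j : ℕ) :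
    ∀ᵐ t ∂(volume.restrict ((φ.updateSlice D hD k g).slice j)),
      HasDerivAt (fun s => (φ.updateSlice D hD k g).val s j)
        (S.flowMap ((φ.updateSlice D hD k g).val t j) ((u.extendZero D hD).val t j).fst) t := by
  set φ' := φ.updateSlice D hD k g
  have hslice_sub : φ.slice j ⊆ φ'.slice j := fun t ht => hsub ht
  rw [← union_sdiff_cancel hslice_sub, ae_restrict_union_iff]
  constructor
  · filter_upwards [h.flow j, φ.ae_mem_interior_slice j] with t ht hti
    have htj : t ∈ φ.slice j := interior_subset hti
    rw [updateSlice_val_of_mem hval htj, extendZero_val_of_mem hD (h.dom_eq ▸ htj)]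
    refine ht.congr_of_eventuallyEq ?_
    filter_upwards [mem_interior_iff_mem_nhds.mp hti] with s hs
    exact updateSlice_val_of_mem hval hs
  · rcases eq_or_ne j k with rfl | hj
    · have hmeas := (φ'.measurableSet_slice j).diff (φ.measurableSet_slice j)
      filter_upwards [hflow, ae_restrict_mem hmeas] with t ht htD
      have htu : (t, j) ∉ u.dom := h.dom_eq ▸ htD.2
      simpa only [φ', updateSlice_val_self, extendZero_val_of_notMem hD htu] using! ht
    · have hempty : φ'.slice j \ φ.slice j = ∅ := sdiff_eq_empty.2 (hslice j hj)
      simp [hempty]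

theorem IsSolutionPair.updateSlice (h : S.IsSolutionPair φ u) (hu : u.IsBoundedOnBoundedTimes)
    (hsub : φ.dom ⊆ D) (hval : EqOn g (fun t => φ.val t k) (φ.slice k))
    (hslice : ∀ j ≠ k, ∀ t, (t, j) ∈ D → (t, j) ∈ φ.dom)
    (harc : ∀ a b, a ≤ b → Icc a b ⊆ {t | (t, k) ∈ D} → AbsolutelyContinuousOnInterval g a b)
    (hmem : ∀ t ∈ interior {t | (t, k) ∈ D}, t ∉ interior (φ.slice k) → g t ∈ S.flowSet)
    (hflow : ∀ᵐ t ∂(volume.restrict ({t | (t, k) ∈ D} \ φ.slice k)),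
      HasDerivAt g (S.flowMap (g t) 0) t)
    (hjump : ∀ t j, j + 1 = k → (t, j) ∈ φ.dom → (t, k) ∈ D → (t, k) ∉ φ.dom →
      φ.val t j ∈ S.jumpSet ∧ g t ∈ S.jumpMap (φ.val t j) (u.val t j).snd) :
    S.IsSolutionPair (φ.updateSlice D hD k g) (u.extendZero D hD) where
  arc j a b hab hj := by
    rcases eq_or_ne j k with rfl | hjk
    · simpa only [updateSlice_val_self] using harc a b hab hj
    · simpa only [updateSlice_val_of_ne hjk] using
        h.arc j a b hab fun t ht => hslice j hjk t (hj ht)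
  input := h.input.extendZero hu hD
  dom_eq := rfl
  init := by
    rw [updateSlice_val_of_mem hval φ.isDomain.zero_mem]
    exact h.init
  flow_mem j t ht := by
    by_cases htj : t ∈ interior (φ.slice j)
    · rw [updateSlice_val_of_mem hval (interior_subset htj : t ∈ φ.slice j)]
      exact h.flow_mem j t htj
    · obtain rfl : j = k := by
        by_contra hjk
        exact htj (interior_mono (hslice j hjk) ht)
      rw [updateSlice_val_self]
      exact hmem t ht htj
  flow := h.updateSlice_flow hsub hval hslice hflow
  jump t j ht ht' := by
    by_cases htj' : (t, j + 1) ∈ φ.dom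
    · have htj := φ.isDomain.mem_of_subset hD hsub htj' ht
      rw [updateSlice_val_of_mem hval htj, updateSlice_val_of_mem hval htj',
        extendZero_val_of_mem hD (h.dom_eq ▸ htj)]
      exact h.jump t j htj htj'
    · obtain rfl : j + 1 = k := by
        by_contra hjk
        exact htj' (hslice _ hjk t ht')
      have htj : (t, j) ∈ φ.dom := hslice j j.succ_ne_self.symm t ht
      rw [updateSlice_val_of_mem hval htj, updateSlice_val_self,
        extendZero_val_of_mem hD (h.dom_eq ▸ htj)]
      exact hjump t j rfl htj ht' htj'

theorem IsSolutionPair.updateSlice_union_Icc (h : S.IsSolutionPair φ u)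
    (hu : u.IsBoundedOnBoundedTimes) {hD : IsHybridTimeDomain (φ.dom ∪ Icc a c ×ˢ {J})}
    (ha : (a, J) ∈ φ.dom) (hc : φ.slice J ⊆ Icc a c)
    (hval : EqOn g (fun t => φ.val t J) (φ.slice J)) (hac : AbsolutelyContinuousOnInterval g a c)
    (hmem : ∀ t ∈ Ioo a c, t ∉ interior (φ.slice J) → g t ∈ S.flowSet)
    (hflow : ∀ᵐ t ∂(volume.restrict (Icc a c \ φ.slice J)), HasDerivAt g (S.flowMap (g t) 0) t) :
    S.IsSolutionPair (φ.updateSlice _ hD J g) (u.extendZero _ hD) := by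
  have hslice : {t | (t, J) ∈ φ.dom ∪ Icc a c ×ˢ {J}} = Icc a c := by
    ext t
    simpa using fun ht : (t, J) ∈ φ.dom => mem_Icc.1 (hc ht)
  refine h.updateSlice hu subset_union_left hval ?_ ?_ ?_ (by rwa [hslice]) ?_
  · rintro j hj t (ht | ht)
    exacts [ht, absurd ht.2 hj]
  · intro s t hst hsub
    rw [hslice] at hsub
    rw [← uIcc_of_le hst, ← uIcc_of_le (hc ha).2] at hsub
    exact hac.mono hsub
  · rwa [hslice, interior_Icc]
  · intro t j hj ht ht' htJ
    have hta : t ≤ a := φ.isDomain.le_of_lt ht ha (by omega)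
    obtain rfl : t = a := hta.antisymm (ht'.resolve_left htJ).1.1
    exact absurd ha htJ

theorem IsSolutionPair.updateSlice_union_singleton (h : S.IsSolutionPair φ u)
    (hu : u.IsBoundedOnBoundedTimes) {hD : IsHybridTimeDomain (φ.dom ∪ {(b, J + 1)})}
    (hlast : ∀ j t, (t, j) ∈ φ.dom → j ≤ J) (hjump : φ.val b J ∈ S.jumpSet) {x : X}
    (hx : x ∈ S.jumpMap (φ.val b J) (u.val b J).snd) :
    S.IsSolutionPair (φ.updateSlice _ hD (J + 1) fun _ => x) (u.extendZero _ hD) := by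
  have hempty : ∀ t, (t, J + 1) ∉ φ.dom := fun t ht => (hlast _ t ht).not_gt J.lt_succ_self
  have hslice : {t | (t, J + 1) ∈ φ.dom ∪ {(b, J + 1)}} = {b} := by
    ext t
    simp [hempty t]
  refine h.updateSlice hu subset_union_left (fun t ht => absurd ht (hempty t)) ?_
    (fun _ _ _ _ => contDiffOn_const.absolutelyContinuousOnInterval) ?_ ?_ ?_
  · rintro j hj t (ht | ht)
    exacts [ht, absurd (Prod.ext_iff.1 ht).2 hj]
  · rw [hslice, interior_singleton]
    exact fun t ht => ht.elim
  · refine ae_restrict_of_ae_restrict_of_subset sdiff_subset ?_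
    rw [hslice]
    simp
  · intro t j hj _ ht' _
    obtain rfl : j = J := by omega
    obtain rfl : t = b := (Prod.ext_iff.1 (ht'.resolve_left (hempty t))).1
    exact ⟨hjump, hx⟩

/-- Viability of the undisturbed flow: a flow starts at `x` and stays in the flow set for a while.
Together with the possibility to jump this is the local existence condition for solutions. -/
def IsViableAt (S : HybridSystem X W N) (x : X) : Prop :=
  ∃ h > 0, ∃ α : ℝ → X, α 0 = x ∧ AbsolutelyContinuousOnInterval α 0 h ∧
    (∀ t ∈ Ico 0 h, α t ∈ S.flowSet) ∧ ∀ t ∈ Ioo 0 h, HasDerivAt α (S.flowMap (α t) 0) t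

theorem IsSolutionPair.exists_updateSlice_of_isViableAt (h : S.IsSolutionPair φ u)
    (hu : u.IsBoundedOnBoundedTimes) (hlast : ∀ j t, (t, j) ∈ φ.dom → j ≤ J) (hab : a ≤ b)
    (hslice : φ.slice J = Icc a b) (hviable : S.IsViableAt (φ.val b J)) :
    ∃ c > b, ∃ (hD : IsHybridTimeDomain (φ.dom ∪ Icc a c ×ˢ {J})) (g : ℝ → X),
      EqOn g (fun t => φ.val t J) (φ.slice J) ∧
      S.IsSolutionPair (φ.updateSlice _ hD J g) (u.extendZero _ hD) := by
  obtain ⟨r, hr, α, hα₀, hαac, hαmem, hα⟩ := hviable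
  have haJ : (a, J) ∈ φ.dom := hslice.symm.subset (left_mem_Icc.2 hab)
  have hbr : b < b + r := lt_add_of_pos_right b hr
  have hsub : φ.slice J ⊆ Icc a (b + r) := hslice.subset.trans (Icc_subset_Icc_right hbr.le)
  have hshift : AbsolutelyContinuousOnInterval (fun t => α (t - b)) b (b + r) := by
    refine absolutelyContinuousOnInterval_comp_monotone hαac (fun t ht => ?_) ?_ ?_
    · rw [uIcc_of_le hbr.le] at ht
      rw [uIcc_of_le hr.le]
      exact ⟨sub_nonneg.2 ht.1, by linarith [ht.2]⟩
    · exact LipschitzWith.of_dist_le_mul fun s t => by simp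
    · exact fun s t hst => sub_le_sub_right hst b
  refine ⟨b + r, hbr, φ.isDomain.union_Icc_prod hlast haJ fun t ht => (hsub ht).2,
    fun t => if t ≤ b then φ.val t J else α (t - b), fun t ht => if_pos (hslice.subset ht).2, ?_⟩
  refine h.updateSlice_union_Icc hu haJ hsub (fun t ht => if_pos (hslice.subset ht).2)
    (absolutelyContinuousOnInterval_ite_le (h.arc J a b hab hslice.superset) hshift hab hbr.le
      (by simp [hα₀])) ?_ ?_
  · intro t ht htint
    rw [hslice, interior_Icc] at htint
    have hbt : b ≤ t := not_lt.1 fun htb => htint ⟨ht.1, htb⟩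
    have hflow := hαmem (t - b) ⟨sub_nonneg.2 hbt, by linarith [ht.2]⟩
    rcases hbt.eq_or_lt with rfl | hlt
    · simpa [hα₀] using hflow
    · simpa only [hlt.not_ge, if_false] using hflow
  · have hsubset : Icc a (b + r) \ φ.slice J ⊆ Icc b (b + r) := fun t ht =>
      ⟨not_lt.1 fun htb => ht.2 (hslice.superset ⟨ht.1.1, htb.le⟩), ht.1.2⟩
    refine ae_restrict_of_ae_restrict_of_subset hsubset ?_
    rw [← restrict_Ioo_eq_restrict_Icc]
    filter_upwards [ae_restrict_mem measurableSet_Ioo] with t ht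
    have hαt := (hα (t - b) ⟨sub_pos.2 ht.1, by linarith [ht.2]⟩).comp_sub_const t b
    simp only [ht.1.not_ge, if_false]
    refine hαt.congr_of_eventuallyEq ?_
    filter_upwards [Ioi_mem_nhds ht.1] with s hs
    exact if_neg (not_le.2 hs)

theorem IsSolutionPair.exists_updateSlice_of_Ico [FiniteDimensional ℝ X]
    (h : S.IsSolutionPair φ u) (hu : u.IsBoundedOnBoundedTimes)
    (hgrowth : ∀ M, ∃ K ≥ 0, ∀ x w, ‖w‖ ≤ M → ‖S.flowMap x w‖ ≤ K * (1 + ‖x‖))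
    (hlast : ∀ j t, (t, j) ∈ φ.dom → j ≤ J) (hab : a < b) (hslice : φ.slice J = Ico a b) :
    ∃ (hD : IsHybridTimeDomain (φ.dom ∪ Icc a b ×ˢ {J})) (g : ℝ → X),
      EqOn g (fun t => φ.val t J) (φ.slice J) ∧
      S.IsSolutionPair (φ.updateSlice _ hD J g) (u.extendZero _ hD) := by
  have haJ : (a, J) ∈ φ.dom := hslice.superset (left_mem_Ico.2 hab)
  have hsub : φ.slice J ⊆ Icc a b := hslice.subset.trans Ico_subset_Icc_self
  obtain ⟨M, hM⟩ := hu J b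
  obtain ⟨K, hK, hKM⟩ := hgrowth M
  have hderiv : ∀ᵐ t ∂(volume.restrict (Ico a b)), ∃ d, ‖d‖ ≤ K * (1 + ‖φ.val t J‖) ∧
      HasDerivAt (fun t => φ.val t J) d t := by
    rw [← h.slice_eq J] at hM
    rw [← hslice]
    filter_upwards [h.flow J, hM, ae_restrict_mem (φ.measurableSet_slice J)] with t ht htM htJ
    exact ⟨_, hKM _ _ ((WithLp.norm_fst_le _ _).trans (htM (hsub htJ).2)), ht⟩
  obtain ⟨C, g, hg, hgeq⟩ := exists_lipschitzWith_eqOn_Ico hK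
    (fun s t has hst htb => h.arc J s t hst fun r hr =>
      hslice.superset ⟨has.trans hr.1, hr.2.trans_lt htb⟩) hderiv
  have hval : EqOn g (fun t => φ.val t J) (φ.slice J) := hslice ▸ hgeq.symm
  refine ⟨φ.isDomain.union_Icc_prod hlast haJ fun t ht => (hsub ht).2, g, hval,
    h.updateSlice_union_Icc hu haJ hsub hval hg.lipschitzOnWith.absolutelyContinuousOnInterval
      (fun t ht htint => absurd ?_ htint) ?_⟩
  · rwa [hslice, interior_Ico]
  · simp [hslice, Icc_sdiff_Ico_same hab.le]

theorem IsMaximalIn.eq_dom_of_updateSlice {𝒰 : Set (HybridSignal (InputPair W N))}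
    (h : S.IsMaximalIn 𝒰 φ u) (hsub : φ.dom ⊆ D)
    (hval : EqOn g (fun t => φ.val t k) (φ.slice k))
    (hsol : S.IsSolutionPair (φ.updateSlice D hD k g) (u.extendZero D hD))
    (hu : u.extendZero D hD ∈ 𝒰) : D = φ.dom :=
  h.2.2 _ _ hsol hu hsub fun _ _ ht =>
    ⟨updateSlice_val_of_mem hval ht, extendZero_val_of_mem hD (h.1.dom_eq ▸ ht)⟩

theorem IsMaximalIn.isComplete [FiniteDimensional ℝ X] {𝒰 : Set (HybridSignal (InputPair W N))}
    (h : S.IsMaximalIn 𝒰 φ u) (hu : u.IsBoundedOnBoundedTimes)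
    (h𝒰 : ∀ D hD, u.extendZero D hD ∈ 𝒰)
    (hgrowth : ∀ M, ∃ K ≥ 0, ∀ x w, ‖w‖ ≤ M → ‖S.flowMap x w‖ ≤ K * (1 + ‖x‖))
    (hviable : ∀ t j, (t, j) ∈ φ.dom →
      (φ.val t j ∈ S.jumpSet ∧ ∀ v, (S.jumpMap (φ.val t j) v).Nonempty) ∨
        S.IsViableAt (φ.val t j)) : φ.IsComplete := by
  by_contra hbdd
  obtain ⟨J, a, b, hlast, ⟨hab, hslice⟩ | ⟨hab, hslice⟩⟩ := φ.isDomain.exists_last_slice hbdd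
  · have hbJ : (b, J) ∈ φ.dom := hslice.superset (right_mem_Icc.2 hab)
    rcases hviable b J hbJ with ⟨hjump, hne⟩ | hflow
    · obtain ⟨x, hx⟩ := hne (u.val b J).snd
      have hgreatest : IsGreatest {r | (r, J) ∈ φ.dom} b := hslice ▸ isGreatest_Icc hab
      have hempty : ∀ t, (t, J + 1) ∉ φ.dom := fun t ht => (hlast _ t ht).not_gt J.lt_succ_self
      have hD := h.eq_dom_of_updateSlice subset_union_left (fun t ht => absurd ht (hempty t))
        (h.1.updateSlice_union_singleton hu (hD := φ.isDomain.union_singleton hlast hgreatest)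
          hlast hjump hx) (h𝒰 _ _)
      exact hempty b (hD.subset (Or.inr rfl))
    · obtain ⟨c, hbc, _, g, hval, hsol⟩ :=
        h.1.exists_updateSlice_of_isViableAt hu hlast hab hslice hflow
      have hD := h.eq_dom_of_updateSlice subset_union_left hval hsol (h𝒰 _ _)
      have hcJ : (c, J) ∈ φ.dom :=
        hD.subset (Or.inr ⟨right_mem_Icc.2 (hab.trans hbc.le), rfl⟩)
      exact (hslice.subset hcJ).2.not_gt hbc
  · obtain ⟨_, g, hval, hsol⟩ := h.1.exists_updateSlice_of_Ico hu hgrowth hlast hab hslice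
    have hD := h.eq_dom_of_updateSlice subset_union_left hval hsol (h𝒰 _ _)
    have hbJ : (b, J) ∈ φ.dom := hD.subset (Or.inr ⟨right_mem_Icc.2 hab.le, rfl⟩)
    exact (hslice.subset hbJ).2.false

end HybridSystem

/-! ### Dwell-time timers -/

namespace HybridSystem

variable {X W N : Type*} [NormedAddCommGroup X] [NormedSpace ℝ X] {S : HybridSystem X W N}

/-- The coordinate `τ` is a timer for the hybrid system: it runs down at unit rate from at most
`T₂`, a jump occurs exactly when it vanishes, and it is then reset to a value between `T₁` and
`T₂`. -/
structure IsTimer (S : HybridSystem X W N) (τ : X →L[ℝ] ℝ) (T₁ T₂ : ℝ) : Prop where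
  pos : 0 < T₁
  le : T₁ ≤ T₂
  flowSet_eq : S.flowSet = {x | τ x ∈ Icc 0 T₂}
  jumpSet_eq : S.jumpSet = {x | τ x = 0}
  map_flowMap : ∀ x w, τ (S.flowMap x w) = -1
  map_jumpMap : ∀ x v, ∀ x' ∈ S.jumpMap x v, τ x' ∈ Icc T₁ T₂

theorem IsTimer.hasDerivAt {τ : X →L[ℝ] ℝ} {T₁ T₂ t : ℝ} (hτ : S.IsTimer τ T₁ T₂)
    {x : ℝ → X} {w : W} (hx : HasDerivAt x (S.flowMap (x t) w) t) :
    HasDerivAt (fun s => τ (x s)) (-1) t :=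
  hτ.map_flowMap (x t) w ▸ τ.hasFDerivAt.comp_hasDerivAt t hx

theorem IsTimer.isViableAt [NormedAddCommGroup W] [CompleteSpace X] {τ : X →L[ℝ] ℝ} {T₁ T₂ : ℝ}
    (hτ : S.IsTimer τ T₁ T₂) {C : NNReal} (hF : LipschitzWith C fun x => S.flowMap x 0) {x : X}
    (hx : τ x ∈ Ioc 0 T₂) : S.IsViableAt x := by
  obtain ⟨α, hα₀, ε, hε, hα⟩ := exists_forall_mem_Ioo_hasDerivAt_of_lipschitzWith hF x 0
  have hr : 0 < min (ε / 2) (τ x) := lt_min (half_pos hε) hx.1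
  set r := min (ε / 2) (τ x)
  have hderiv : ∀ t ∈ Icc 0 r, HasDerivAt α (S.flowMap (α t) 0) t := fun t ht =>
    hα t ⟨by linarith [ht.1], by linarith [ht.2, min_le_left (ε / 2) (τ x)]⟩
  have hcont : ContinuousOn α (Icc 0 r) := fun t ht => (hderiv t ht).continuousAt.continuousWithinAt
  have htimer : ∀ t ∈ Icc 0 r, τ (α t) = τ x - t := by
    have hconst := constant_of_has_deriv_right_zero (f := fun t => τ (α t) + t)
      ((τ.continuous.comp_continuousOn hcont).add continuousOn_id) fun t ht =>
        (((hτ.hasDerivAt (hderiv t (Ico_subset_Icc_self ht))).add (hasDerivAt_id t)).congr_deriv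
          (neg_add_cancel 1)).hasDerivWithinAt
    intro t ht
    have := hconst t ht
    rw [hα₀] at this
    linarith
  refine ⟨r, hr, α, hα₀, ?_, fun t ht => ?_, fun t ht => hderiv t (Ioo_subset_Icc_self ht)⟩
  · rw [← uIcc_of_le hr.le] at hderiv hcont
    exact absolutelyContinuousOnInterval_of_hasDerivAt hderiv
      (hF.continuous.comp_continuousOn hcont)
  · rw [hτ.flowSet_eq, mem_ofPred_eq, htimer t (Ico_subset_Icc_self ht)]
    exact ⟨by linarith [ht.2, min_le_right (ε / 2) (τ x)], by linarith [ht.1, hx.2]⟩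

variable [NormedAddCommGroup W] [MeasurableSpace W] [NormedAddCommGroup N] [MeasurableSpace N]
  {φ : HybridSignal X} {u : HybridSignal (InputPair W N)}
  {t : ℝ} {j : ℕ}

theorem IsSolutionPair.mem_of_isClosed (h : S.IsSolutionPair φ u) {K : Set X} (hK : IsClosed K)
    (hflow : S.flowSet ⊆ K) (hjump : S.jumpSet ⊆ K) (hmap : ∀ x v, S.jumpMap x v ⊆ K)
    (ht : (t, j) ∈ φ.dom) : φ.val t j ∈ K := by
  refine φ.isDomain.induction (P := fun t j => φ.val t j ∈ K) ?_ (fun j a b hab ha hb haK => ?_)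
    (fun t j ht ht' _ => hmap _ _ (h.jump t j ht ht').2) ht
  · exact h.init.elim (fun hinit => closure_minimal hflow hK hinit) fun hinit => hjump hinit
  · rcases hab.eq_or_lt with rfl | hlt
    · exact haK
    have hsub := φ.Icc_subset_slice ha hb
    have hcont := (h.arc j a b hab hsub).continuousOn
    rw [uIcc_of_le hab] at hcont
    have hmaps : MapsTo (fun t => φ.val t j) (Ioo a b) K := fun t ht =>
      hflow (h.flow_mem j t (interior_mono hsub (by rwa [interior_Icc])))
    have hb_closure : b ∈ closure (Ioo a b) := closure_Ioo hlt.ne ▸ right_mem_Icc.2 hab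
    exact hK.closure_subset
      (((hcont b (right_mem_Icc.2 hab)).mono Ioo_subset_Icc_self).mem_closure hb_closure hmaps)

namespace IsTimer

variable {τ : X →L[ℝ] ℝ} {T₁ T₂ : ℝ}

theorem mem_flowSet (hτ : S.IsTimer τ T₁ T₂) (h : S.IsSolutionPair φ u) (ht : (t, j) ∈ φ.dom) :
    φ.val t j ∈ S.flowSet := by
  refine h.mem_of_isClosed ?_ subset_rfl ?_ ?_ ht
  · rw [hτ.flowSet_eq]
    exact isClosed_Icc.preimage τ.continuous
  · rw [hτ.flowSet_eq, hτ.jumpSet_eq]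
    exact fun x (hx : τ x = 0) => ⟨hx.ge, hx.trans_le (hτ.pos.le.trans hτ.le)⟩
  · intro x v x' hx'
    rw [hτ.flowSet_eq]
    exact ⟨hτ.pos.le.trans (hτ.map_jumpMap x v x' hx').1, (hτ.map_jumpMap x v x' hx').2⟩

theorem mem_Icc (hτ : S.IsTimer τ T₁ T₂) (h : S.IsSolutionPair φ u) (ht : (t, j) ∈ φ.dom) :
    τ (φ.val t j) ∈ Icc 0 T₂ :=
  hτ.flowSet_eq.subset (hτ.mem_flowSet h ht)

theorem map_val_of_jump (hτ : S.IsTimer τ T₁ T₂) (h : S.IsSolutionPair φ u)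
    (ht : (t, j) ∈ φ.dom) (ht' : (t, j + 1) ∈ φ.dom) : τ (φ.val t j) = 0 :=
  hτ.jumpSet_eq.subset (h.jump t j ht ht').1

theorem le_map_val_of_jump (hτ : S.IsTimer τ T₁ T₂) (h : S.IsSolutionPair φ u)
    (ht : (t, j) ∈ φ.dom) (ht' : (t, j + 1) ∈ φ.dom) : T₁ ≤ τ (φ.val t (j + 1)) :=
  (hτ.map_jumpMap _ _ _ (h.jump t j ht ht').2).1

theorem natCast_mul_le (hτ : S.IsTimer τ T₁ T₂) (h : S.IsSolutionPair φ u)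
    (ht : (t, j) ∈ φ.dom) : j * T₁ ≤ t + T₂ := by
  have hbound := φ.le_exp_mul_of_flow_of_jump (κ := 0)
    (g := fun t j => j * T₁ - t - τ (φ.val t j)) (fun j a b hab hsub => ?_) (fun j => ?_)
    (fun t j ht ht' => ?_) ht
  · have hnonneg := (hτ.mem_Icc h φ.isDomain.zero_mem).1
    have hle := (hτ.mem_Icc h ht).2
    simp only [zero_mul, Real.exp_zero, one_mul, Nat.cast_zero, zero_sub] at hbound
    linarith
  · have hlin : AbsolutelyContinuousOnInterval (fun t : ℝ => j * T₁ - t) a b :=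
      ContDiff.contDiffOn (by fun_prop) |>.absolutelyContinuousOnInterval
    exact hlin.sub (absolutelyContinuousOnInterval_comp_contDiff (h.arc j a b hab hsub) τ.contDiff)
  · filter_upwards [h.flow j] with t ht
    exact ⟨-1 - -1, by simp, ((hasDerivAt_id t).const_sub (j * T₁)).sub (hτ.hasDerivAt ht)⟩
  · simp only [hτ.map_val_of_jump h ht ht']
    push_cast
    linarith [hτ.le_map_val_of_jump h ht ht']

theorem exp_neg_mul_le (hτ : S.IsTimer τ T₁ T₂) {rate : ℝ} (hrate : 0 ≤ rate)
    (h : S.IsSolutionPair φ u) (ht : (t, j) ∈ φ.dom) :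
    Real.exp (-rate * t) ≤
      Real.exp (rate * T₂ / 2) * Real.exp (-(rate / 2 * min 1 T₁) * (t + j)) := by
  rw [← Real.exp_add, Real.exp_le_exp]
  have ht₀ := φ.isDomain.nonneg ht
  have hsum : min 1 T₁ * (t + j) ≤ 2 * t + T₂ := by
    have hflow : min 1 T₁ * t ≤ 1 * t := by gcongr; exact min_le_left _ _
    have hjump : min 1 T₁ * j ≤ T₁ * j := by gcongr; exact min_le_right _ _
    linarith [hτ.natCast_mul_le h ht]
  linarith [mul_le_mul_of_nonneg_left hsum (div_nonneg hrate zero_le_two)]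

theorem isComplete_of_isMaximalIn [FiniteDimensional ℝ X] (hτ : S.IsTimer τ T₁ T₂) {C : NNReal}
    (hF : LipschitzWith C (Function.uncurry S.flowMap)) (hjump : ∀ x v, (S.jumpMap x v).Nonempty)
    {𝒰 : Set (HybridSignal (InputPair W N))} (h : S.IsMaximalIn 𝒰 φ u)
    (hu : u.IsBoundedOnBoundedTimes) (h𝒰 : ∀ D hD, u.extendZero D hD ∈ 𝒰) : φ.IsComplete := by
  have := FiniteDimensional.complete ℝ X
  refine h.isComplete hu h𝒰 (fun M => ?_) fun t j ht => ?_
  · refine ⟨‖S.flowMap 0 0‖ + C * (1 + |M|), by positivity, fun x w hw => ?_⟩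
    have hxw : ‖(x, w)‖ ≤ (1 + |M|) * (1 + ‖x‖) :=
      max_le (by nlinarith [norm_nonneg x, abs_nonneg M])
        (by nlinarith [norm_nonneg x, abs_nonneg M, hw.trans (le_abs_self M)])
    have hlip : ‖S.flowMap x w - S.flowMap 0 0‖ ≤ C * ‖(x, w)‖ := by
      simpa using! hF.norm_sub_le (x, w) 0
    calc ‖S.flowMap x w‖ ≤ ‖S.flowMap 0 0‖ + ‖S.flowMap x w - S.flowMap 0 0‖ :=
          norm_le_insert' _ _
      _ ≤ ‖S.flowMap 0 0‖ * (1 + ‖x‖) + C * ((1 + |M|) * (1 + ‖x‖)) := by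
          gcongr
          · exact le_mul_of_one_le_right (norm_nonneg _) (by linarith [norm_nonneg x])
          · exact hlip.trans (by gcongr)
      _ = (‖S.flowMap 0 0‖ + C * (1 + |M|)) * (1 + ‖x‖) := by ring
  · have hval := hτ.mem_Icc h.1 ht
    rcases hval.1.eq_or_lt with hzero | hpos
    · exact Or.inl ⟨hτ.jumpSet_eq.superset hzero.symm, hjump _⟩
    · have hF₀ := hF.comp (LipschitzWith.prodMk_right (0 : W))
      exact Or.inr (hτ.isViableAt (by simpa using! hF₀) ⟨hpos, hval.2⟩)

end IsTimer

end HybridSystem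

/-! ### Storage functions -/

theorem eLpNorm_two_eq_lintegral_ofReal_sq {α E : Type*} [MeasurableSpace α]
    [NormedAddCommGroup E] (f : α → E) (μ : Measure α) :
    eLpNorm f 2 μ = (∫⁻ x, ENNReal.ofReal (‖f x‖ ^ 2) ∂μ) ^ (1 / 2 : ℝ) := by
  rw [eLpNorm_eq_lintegral_rpow_enorm_toReal two_ne_zero ENNReal.ofNat_ne_top]
  simp only [ENNReal.toReal_ofNat, ENNReal.rpow_ofNat, ENNReal.ofReal_pow (norm_nonneg _),
    ofReal_norm]

theorem eLpNorm_two_le_add_of_lintegral_sq_le {α β E F : Type*} [MeasurableSpace α]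
    [MeasurableSpace β] [NormedAddCommGroup E] [NormedAddCommGroup F] {μ : Measure α}
    {ν : Measure β} {f : α → E} {g : β → F} {c γ : ℝ} (hc : 0 ≤ c) (hγ : 0 ≤ γ)
    (h : ∫⁻ x, ENNReal.ofReal (‖f x‖ ^ 2) ∂μ ≤
      ENNReal.ofReal (c ^ 2) + ∫⁻ x, ENNReal.ofReal (γ ^ 2 * ‖g x‖ ^ 2) ∂ν) :
    eLpNorm f 2 μ ≤ ENNReal.ofReal c + ENNReal.ofReal γ * eLpNorm g 2 ν := by
  have hscale : ENNReal.ofReal γ * eLpNorm g 2 ν =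
      (∫⁻ x, ENNReal.ofReal (γ ^ 2 * ‖g x‖ ^ 2) ∂ν) ^ (1 / 2 : ℝ) := by
    rw [← eLpNorm_norm g, ← Real.enorm_of_nonneg hγ, ← eLpNorm_const_smul,
      eLpNorm_two_eq_lintegral_ofReal_sq]
    simp [mul_pow]
  have hsqrt : ENNReal.ofReal (c ^ 2) ^ (1 / 2 : ℝ) = ENNReal.ofReal c := by
    rw [ENNReal.ofReal_rpow_of_nonneg (sq_nonneg c) (by norm_num), ← Real.sqrt_eq_rpow,
      Real.sqrt_sq hc]
  rw [hscale, ← hsqrt, eLpNorm_two_eq_lintegral_ofReal_sq]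
  exact (ENNReal.rpow_le_rpow h (by norm_num)).trans
    (ENNReal.rpow_add_le_add_rpow _ _ (by norm_num) (by norm_num))

theorem exists_nonneg_mul_eq_sub {q c : ℝ} (hq : q < 1) (hc : 0 ≤ c) :
    ∃ B ≥ 0, B * q = B - c := by
  have hpos : 0 < 1 - q := sub_pos.2 hq
  exact ⟨c / (1 - q), by positivity, by field_simp; ring⟩

namespace HybridSystem

section Storage

variable {X W N P : Type*} [NormedAddCommGroup X] [NormedSpace ℝ X] [NormedAddCommGroup W]
  [NormedAddCommGroup N] [NormedAddCommGroup P] {S : HybridSystem X W N} {𝒜 : Set X} {h : X → P}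
  {a γ : ℝ} {V : X → ℝ}

/-- `V` is a storage function for the hybrid system with output `h`: along flows it decays with
rate `a` up to the supply `γ² |w|² - |h|²`, at jumps it grows by at most a multiple of the squared
jump input, and on the flow set it is comparable to the squared distance to `𝒜`. -/
structure IsStorage (S : HybridSystem X W N) (𝒜 : Set X) (h : X → P) (a γ : ℝ) (V : X → ℝ) :
    Prop where
  contDiff : ContDiff ℝ 1 V
  nonneg : ∀ x, 0 ≤ V x
  flow : ∀ x ∈ S.flowSet, ∀ w,
    fderiv ℝ V x (S.flowMap x w) + a * V x + ‖h x‖ ^ 2 ≤ γ ^ 2 * ‖w‖ ^ 2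
  exists_jump_le : ∃ c ≥ 0, ∀ x v, ∀ x' ∈ S.jumpMap x v, V x' ≤ V x + c * ‖v‖ ^ 2
  exists_infDist_sq_le : ∃ c > 0, ∀ x ∈ S.flowSet, Metric.infDist x 𝒜 ^ 2 ≤ c * V x
  exists_le_infDist_sq : ∃ c > 0, ∀ x ∈ S.flowSet, V x ≤ c * Metric.infDist x 𝒜 ^ 2

theorem IsStorage.hasDerivAt (hV : S.IsStorage 𝒜 h a γ V) {x : ℝ → X} {x' : X} {t : ℝ}
    (hx : HasDerivAt x x' t) : HasDerivAt (fun s => V (x s)) (fderiv ℝ V (x t) x') t :=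
  (hV.contDiff.differentiable one_ne_zero (x t)).hasFDerivAt.comp_hasDerivAt t hx

end Storage

variable {X W N P : Type*} [NormedAddCommGroup X] [NormedSpace ℝ X]
  [NormedAddCommGroup W] [MeasurableSpace W] [NormedAddCommGroup N] [MeasurableSpace N]
  [NormedAddCommGroup P] {S : HybridSystem X W N} {𝒜 : Set X} {h : X → P} {a lam γ T₁ T₂ : ℝ}
  {V : X → ℝ} {τ : X →L[ℝ] ℝ}

namespace IsStorage

/-- The weight `e^(a (τ - T₁))` is constant up to the decay `e^(-a t)` along flows and drops from at
least `1` to `e^(-a T₁)` over each dwell time, which makes room for the growth of `V` at jumps. -/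
theorem exists_le_exp_mul (hV : S.IsStorage 𝒜 h a γ V) (hτ : S.IsTimer τ T₁ T₂) (ha : 0 < a) :
    ∃ K ≥ 0, ∀ φ u, S.IsSolutionPair φ u → ∀ r, u.IsBoundedBy r → ∀ t j, (t, j) ∈ φ.dom →
      V (φ.val t j) ≤ Real.exp (-a * t) * V (φ.val 0 0) + K * r ^ 2 := by
  obtain ⟨c, hc, hjump⟩ := hV.exists_jump_le
  obtain ⟨B, hB, hBdrop⟩ := exists_nonneg_mul_eq_sub
    (Real.exp_lt_one_iff.2 (mul_neg_of_neg_of_pos (neg_neg_of_pos ha) hτ.pos)) hc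
  refine ⟨B * Real.exp (a * (T₂ - T₁)) + γ ^ 2 / a, by positivity,
    fun φ u hsol r hu t j ht => ?_⟩
  have hdecay := φ.le_exp_mul_of_flow_of_jump (κ := -a) (g := fun t j => V (φ.val t j)
    - B * r ^ 2 * Real.exp (a * (τ (φ.val t j) - T₁)) - γ ^ 2 * r ^ 2 / a)
    (fun j s t hst hsub => ?_) (fun j => ?_) (fun t j ht ht' => ?_) ht
  · have hτle : B * r ^ 2 * Real.exp (a * (τ (φ.val t j) - T₁)) ≤
        B * r ^ 2 * Real.exp (a * (T₂ - T₁)) := by gcongr; exact (hτ.mem_Icc hsol ht).2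
    have hinit : Real.exp (-a * t) * (V (φ.val 0 0)
        - B * r ^ 2 * Real.exp (a * (τ (φ.val 0 0) - T₁)) - γ ^ 2 * r ^ 2 / a)
        ≤ Real.exp (-a * t) * V (φ.val 0 0) := by
      rw [sub_sub]
      gcongr
      exact sub_le_self _ (by positivity)
    linarith [div_mul_eq_mul_div (γ ^ 2) a (r ^ 2)]
  · exact absolutelyContinuousOnInterval_comp_contDiff (g := fun x => V x
      - B * r ^ 2 * Real.exp (a * (τ x - T₁)) - γ ^ 2 * r ^ 2 / a) (hsol.arc j s t hst hsub)
      (by have := hV.contDiff; fun_prop)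
  · have hbound := hu.ae_norm_le j
    rw [← hsol.slice_eq j] at hbound
    filter_upwards [hsol.flow j, hbound, ae_restrict_mem (φ.measurableSet_slice j)]
      with t hx hut htj
    have hweight := (((hτ.hasDerivAt hx).sub_const T₁).const_mul a).exp.const_mul (B * r ^ 2)
    refine ⟨_, ?_, ((hV.hasDerivAt hx).sub hweight).sub_const _⟩
    have hw : γ ^ 2 * ‖(u.val t j).fst‖ ^ 2 ≤ γ ^ 2 * r ^ 2 := by
      gcongr
      exact (WithLp.norm_fst_le _ _).trans hut
    linarith [hV.flow _ (hτ.mem_flowSet hsol htj) (u.val t j).fst,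
      sq_nonneg ‖h (φ.val t j)‖, mul_div_cancel₀ (γ ^ 2 * r ^ 2) ha.ne']
  · have hη : c * ‖(u.val t j).snd‖ ^ 2 ≤ c * r ^ 2 := by
      gcongr
      exact (WithLp.norm_snd_le _ _).trans
        (hu.norm_le t j (hsol.dom_eq ▸ ht) (hsol.dom_eq ▸ ht'))
    have hreset : B * r ^ 2 * 1 ≤ B * r ^ 2 * Real.exp (a * (τ (φ.val t (j + 1)) - T₁)) := by
      gcongr
      exact Real.one_le_exp (mul_nonneg ha.le (sub_nonneg.2 (hτ.le_map_val_of_jump hsol ht ht')))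
    have hdrop : B * r ^ 2 * Real.exp (a * (0 - T₁)) = (B - c) * r ^ 2 := by
      rw [mul_right_comm, ← hBdrop, zero_sub, mul_neg, neg_mul]
    rw [hτ.map_val_of_jump hsol ht ht', hdrop]
    linarith [hjump _ _ _ (hsol.jump t j ht ht').2]

theorem exists_infDist_le (hV : S.IsStorage 𝒜 h (2 * lam) γ V) (hτ : S.IsTimer τ T₁ T₂)
    (hlam : 0 < lam) :
    ∃ κ > 0, ∃ κ' ≥ 0, ∀ φ u, S.IsSolutionPair φ u → ∀ r ≥ 0, u.IsBoundedBy r →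
      ∀ t j, (t, j) ∈ φ.dom → Metric.infDist (φ.val t j) 𝒜 ≤
        κ * Real.exp (-lam * t) * Metric.infDist (φ.val 0 0) 𝒜 + κ' * r := by
  obtain ⟨K, hK, hdecay⟩ := hV.exists_le_exp_mul hτ (by positivity)
  obtain ⟨c₁, hc₁, hlower⟩ := hV.exists_infDist_sq_le
  obtain ⟨c₂, hc₂, hupper⟩ := hV.exists_le_infDist_sq
  refine ⟨√(c₁ * c₂), by positivity, √(c₁ * K), by positivity, fun φ u hsol r hr hu t j ht => ?_⟩
  set d := Metric.infDist (φ.val t j) 𝒜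
  set d₀ := Metric.infDist (φ.val 0 0) 𝒜
  have hd₀ : 0 ≤ d₀ := Metric.infDist_nonneg
  have hexp : Real.exp (-(2 * lam) * t) = Real.exp (-lam * t) ^ 2 := by
    rw [← Real.exp_nat_mul]
    push_cast
    ring_nf
  refine le_of_sq_le_sq ?_ (by positivity)
  calc d ^ 2 ≤ c₁ * V (φ.val t j) := hlower _ (hτ.mem_flowSet hsol ht)
    _ ≤ c₁ * (Real.exp (-(2 * lam) * t) * V (φ.val 0 0) + K * r ^ 2) := by
        gcongr
        exact hdecay φ u hsol r hu t j ht
    _ ≤ c₁ * (Real.exp (-lam * t) ^ 2 * (c₂ * d₀ ^ 2) + K * r ^ 2) := by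
        rw [hexp]
        gcongr
        exact hupper _ (hτ.mem_flowSet hsol φ.isDomain.zero_mem)
    _ = √(c₁ * c₂) ^ 2 * Real.exp (-lam * t) ^ 2 * d₀ ^ 2 + √(c₁ * K) ^ 2 * r ^ 2 := by
        rw [Real.sq_sqrt (by positivity), Real.sq_sqrt (by positivity)]
        ring
    _ ≤ (√(c₁ * c₂) * Real.exp (-lam * t) * d₀ + √(c₁ * K) * r) ^ 2 := by
        have : 0 ≤ √(c₁ * c₂) * Real.exp (-lam * t) * d₀ * (√(c₁ * K) * r) := by positivity
        linarith

theorem isGloballyExpStable [FiniteDimensional ℝ X] (hV : S.IsStorage 𝒜 h (2 * lam) γ V)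
    (hτ : S.IsTimer τ T₁ T₂) (hlam : 0 < lam) {C : NNReal}
    (hF : LipschitzWith C (Function.uncurry S.flowMap))
    (hjump : ∀ x v, (S.jumpMap x v).Nonempty) : S.IsGloballyExpStable 𝒜 lam := by
  refine ⟨fun φ u hmax => hτ.isComplete_of_isMaximalIn hF hjump hmax
    (isBoundedOnBoundedTimes_of_mem_zeroInputs hmax.2.1)
    fun D hD => extendZero_mem_zeroInputs hmax.2.1 hD, ?_⟩
  obtain ⟨κ, hκ, κ', -, hle⟩ := hV.exists_infDist_le hτ hlam
  refine ⟨κ, hκ, fun φ u hsol hu t j ht => ?_⟩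
  simpa only [mul_zero, add_zero] using
    hle φ u hsol 0 le_rfl (isBoundedBy_zero_of_mem_zeroInputs hu) t j ht

theorem isExpISS [FiniteDimensional ℝ X] (hV : S.IsStorage 𝒜 h (2 * lam) γ V)
    (hτ : S.IsTimer τ T₁ T₂) (hlam : 0 < lam) {C : NNReal}
    (hF : LipschitzWith C (Function.uncurry S.flowMap))
    (hjump : ∀ x v, (S.jumpMap x v).Nonempty) : S.IsExpISS 𝒜 := by
  refine ⟨fun φ u hmax hu => hτ.isComplete_of_isMaximalIn hF hjump hmax
    (HybridSignal.isBoundedOnBoundedTimes_of_truncSupNorm_lt_top hu) fun _ _ => mem_univ _, ?_⟩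
  obtain ⟨κ, hκ, κ', hκ', hle⟩ := hV.exists_infDist_le hτ hlam
  have hdwell : 0 < min 1 T₁ := lt_min one_pos hτ.pos
  refine ⟨2 * (κ * Real.exp (lam * T₂ / 2)), by positivity, lam / 2 * min 1 T₁, by positivity,
    fun r => (2 * κ' + 1) * r, by fun_prop, fun r _ s _ hrs => ?_, mul_zero _,
    fun φ u hsol hu t j ht => ?_⟩
  · exact mul_lt_mul_of_pos_left hrs (by positivity)
  set d₀ := Metric.infDist (φ.val 0 0) 𝒜
  set r := u.supNorm.toReal
  have hr : 0 ≤ r := ENNReal.toReal_nonneg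
  have hrate : κ * Real.exp (-lam * t) * d₀ ≤
      κ * Real.exp (lam * T₂ / 2) * Real.exp (-(lam / 2 * min 1 T₁) * (t + j)) * d₀ := by
    rw [mul_assoc κ (Real.exp (lam * T₂ / 2))]
    gcongr
    · exact Metric.infDist_nonneg
    · exact hτ.exp_neg_mul_le hlam.le hsol ht
  have hbound := hle φ u hsol r hr (u.isBoundedBy_supNorm hu) t j ht
  rcases le_total (κ * Real.exp (-lam * t) * d₀) (κ' * r) with hinput | hdecay
  · exact le_max_of_le_right (by linarith)
  · exact le_max_of_le_left (by linarith)

theorem isL2Stable (hV : S.IsStorage 𝒜 h a γ V) (hτ : S.IsTimer τ T₁ T₂) (ha : 0 ≤ a)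
    (hγ : 0 ≤ γ) : S.IsL2Stable h 𝒜 γ := by
  obtain ⟨c, hc, hupper⟩ := hV.exists_le_infDist_sq
  obtain ⟨_, _, hjump⟩ := hV.exists_jump_le
  refine ⟨√c, by positivity, fun φ u hsol hη => ?_⟩
  have hdissip := φ.lintegral_domT_le_of_flow_of_jump (v := fun t j => V (φ.val t j))
    (f := fun t j => ‖h (φ.val t j)‖ ^ 2) (g := fun t j => γ ^ 2 * ‖(u.val t j).fst‖ ^ 2)
    (fun _ _ => sq_nonneg _) (fun _ _ => hV.nonneg _)
    (fun j s t hst hsub =>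
      absolutelyContinuousOnInterval_comp_contDiff (hsol.arc j s t hst hsub) hV.contDiff)
    (fun j => ?_) (fun t j ht ht' => ?_)
  · have hT : u.domT = φ.domT := by simp only [HybridSignal.domT, hsol.dom_eq]
    have hj : u.jmin = φ.jmin := by ext t; simp only [HybridSignal.jmin, hsol.dom_eq]
    rw [hT, hj]
    refine eLpNorm_two_le_add_of_lintegral_sq_le
      (mul_nonneg (Real.sqrt_nonneg c) Metric.infDist_nonneg) hγ (hdissip.trans ?_)
    rw [mul_pow, Real.sq_sqrt hc.le]
    gcongr
    exact hupper _ (hτ.mem_flowSet hsol φ.isDomain.zero_mem)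
  · filter_upwards [hsol.flow j, ae_restrict_mem (φ.measurableSet_slice j)] with t hx htj
    refine ⟨_, ?_, hV.hasDerivAt hx⟩
    linarith [hV.flow _ (hτ.mem_flowSet hsol htj) (u.val t j).fst,
      mul_nonneg ha (hV.nonneg (φ.val t j))]
  · have hle := hjump _ _ _ (hsol.jump t j ht ht').2
    rw [hη t j (hsol.dom_eq ▸ ht)] at hle
    simpa using hle

end IsStorage

end HybridSystem

/-! ### Quadratic forms -/

/-- Positive definiteness is uniform, by compactness of the unit sphere. -/
theorem exists_norm_sq_le_mul_reApplyInnerSelf {E : Type*} [NormedAddCommGroup E]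
    [InnerProductSpace ℝ E] [FiniteDimensional ℝ E] {T : E →L[ℝ] E}
    (hT : ∀ x ≠ 0, 0 < T.reApplyInnerSelf x) :
    ∃ K > 0, ∀ x, ‖x‖ ^ 2 ≤ K * T.reApplyInnerSelf x := by
  obtain ⟨c, hc, hcT⟩ := (isCompact_sphere (0 : E) 1).exists_forall_le'
    T.reApplyInnerSelf_continuous.continuousOn
    fun x hx => hT x (ne_zero_of_mem_unit_sphere ⟨x, hx⟩)
  refine ⟨c⁻¹, inv_pos.mpr hc, fun x => ?_⟩
  rw [← div_eq_inv_mul, le_div_iff₀' hc]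
  rcases eq_or_ne x 0 with rfl | hx
  · simp [ContinuousLinearMap.reApplyInnerSelf_apply]
  have hsphere := hcT (‖x‖⁻¹ • x) (by simp [norm_smul, hx])
  rwa [T.reApplyInnerSelf_smul, norm_inv, norm_norm, inv_pow, ← div_eq_inv_mul,
    le_div_iff₀ (by positivity)] at hsphere

theorem reApplyInnerSelf_le {E : Type*} [NormedAddCommGroup E] [InnerProductSpace ℝ E]
    (T : E →L[ℝ] E) (x : E) : T.reApplyInnerSelf x ≤ ‖T‖ * ‖x‖ ^ 2 :=
  calc T.reApplyInnerSelf x ≤ ‖T x‖ * ‖x‖ := real_inner_le_norm _ _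
    _ ≤ ‖T‖ * ‖x‖ * ‖x‖ := by gcongr; exact T.le_opNorm x
    _ = ‖T‖ * ‖x‖ ^ 2 := by ring

theorem norm_map_le_mul_infDist {E F : Type*} [NormedAddCommGroup E] [NormedSpace ℝ E]
    [NormedAddCommGroup F] [NormedSpace ℝ F] {f : E →L[ℝ] F} {s : Set E} (hs : s.Nonempty)
    (hf : ∀ a ∈ s, f a = 0) (x : E) : ‖f x‖ ≤ ‖f‖ * Metric.infDist x s := by
  rw [Metric.infDist_eq_iInf]
  have := hs.to_subtype
  rw [Real.mul_iInf_of_nonneg (norm_nonneg f)]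
  refine le_ciInf fun a => ?_
  calc ‖f x‖ = ‖f (x - a)‖ := by rw [map_sub, hf a a.2, sub_zero]
    _ ≤ ‖f‖ * dist x a := by rw [dist_eq_norm]; exact f.le_opNorm _

section WeightedForm

variable {X E F : Type*} [NormedAddCommGroup X] [NormedSpace ℝ X] [NormedAddCommGroup E]
  [InnerProductSpace ℝ E] [NormedAddCommGroup F] [InnerProductSpace ℝ F]

/-- The form `⟪P e, e⟫ + exp (δ τ) ⟪Q f, f⟫` in the linear coordinates `e`, `f` and `τ` of a space.
While the timer `τ` decreases at unit rate, the weight makes the second term decay at rate `δ`. -/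
def timerWeightedForm (P : E →L[ℝ] E) (Q : F →L[ℝ] F) (δ : ℝ) (e : X →L[ℝ] E) (f : X →L[ℝ] F)
    (τ : X →L[ℝ] ℝ) (x : X) : ℝ :=
  P.reApplyInnerSelf (e x) + Real.exp (δ * τ x) * Q.reApplyInnerSelf (f x)

variable {P : E →L[ℝ] E} {Q : F →L[ℝ] F} {δ T : ℝ} {e : X →L[ℝ] E} {f : X →L[ℝ] F} {τ : X →L[ℝ] ℝ}

theorem contDiff_timerWeightedForm : ContDiff ℝ 1 (timerWeightedForm P Q δ e f τ) :=
  ((P.contDiff.comp e.contDiff).inner ℝ e.contDiff).add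
    ((contDiff_const.mul τ.contDiff).exp.mul ((Q.contDiff.comp f.contDiff).inner ℝ f.contDiff))

theorem fderiv_timerWeightedForm (hP : (P : E →ₗ[ℝ] E).IsSymmetric)
    (hQ : (Q : F →ₗ[ℝ] F).IsSymmetric) (x v : X) :
    fderiv ℝ (timerWeightedForm P Q δ e f τ) x v = 2 * inner ℝ (P (e x)) (e v) +
      Real.exp (δ * τ x) *
        (2 * inner ℝ (Q (f x)) (f v) + δ * τ v * Q.reApplyInnerSelf (f x)) := by
  have hPe := (hP.hasStrictFDerivAt_reApplyInnerSelf (e x)).hasFDerivAt.comp x e.hasFDerivAt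
  have hQf := (hQ.hasStrictFDerivAt_reApplyInnerSelf (f x)).hasFDerivAt.comp x f.hasFDerivAt
  have hexp := (τ.hasFDerivAt (x := x).const_mul δ).exp
  have hform : HasFDerivAt (timerWeightedForm P Q δ e f τ) _ x := hPe.add (hexp.mul hQf)
  rw [hform.fderiv]
  simp only [ContinuousLinearMap.smul_comp, add_apply, smul_apply,
    ContinuousLinearMap.comp_apply, coe_innerSL_apply, nsmul_eq_mul, Nat.cast_ofNat, smul_eq_mul]
  ring

theorem timerWeightedForm_nonneg (hP : ∀ v, 0 ≤ P.reApplyInnerSelf v)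
    (hQ : ∀ v, 0 ≤ Q.reApplyInnerSelf v) (x : X) : 0 ≤ timerWeightedForm P Q δ e f τ x :=
  add_nonneg (hP _) (mul_nonneg (Real.exp_pos _).le (hQ _))

theorem exists_norm_sq_add_norm_sq_le_timerWeightedForm [FiniteDimensional ℝ E]
    [FiniteDimensional ℝ F] (hP : ∀ v ≠ 0, 0 < P.reApplyInnerSelf v)
    (hQ : ∀ v ≠ 0, 0 < Q.reApplyInnerSelf v) (hδ : 0 ≤ δ) :
    ∃ c > 0, ∀ x, 0 ≤ τ x → ‖e x‖ ^ 2 + ‖f x‖ ^ 2 ≤ c * timerWeightedForm P Q δ e f τ x := by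
  obtain ⟨K, hK, hPK⟩ := exists_norm_sq_le_mul_reApplyInnerSelf hP
  obtain ⟨M, hM, hQM⟩ := exists_norm_sq_le_mul_reApplyInnerSelf hQ
  refine ⟨max K M, lt_max_of_lt_left hK, fun x hx => ?_⟩
  have hP₀ : 0 ≤ P.reApplyInnerSelf (e x) :=
    nonneg_of_mul_nonneg_right ((sq_nonneg _).trans (hPK _)) hK
  have hQ₀ : 0 ≤ Q.reApplyInnerSelf (f x) :=
    nonneg_of_mul_nonneg_right ((sq_nonneg _).trans (hQM _)) hM
  calc ‖e x‖ ^ 2 + ‖f x‖ ^ 2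
      ≤ max K M * P.reApplyInnerSelf (e x) + max K M * Q.reApplyInnerSelf (f x) :=
        add_le_add ((hPK _).trans (by gcongr; exact le_max_left _ _))
          ((hQM _).trans (by gcongr; exact le_max_right _ _))
    _ ≤ max K M * P.reApplyInnerSelf (e x) +
          max K M * (Real.exp (δ * τ x) * Q.reApplyInnerSelf (f x)) := by
        gcongr
        exact le_mul_of_one_le_left hQ₀ (Real.one_le_exp (mul_nonneg hδ hx))
    _ = max K M * timerWeightedForm P Q δ e f τ x := by rw [timerWeightedForm, mul_add]

theorem exists_timerWeightedForm_le_infDist_sq {s : Set X} (hs : s.Nonempty)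
    (he : ∀ x ∈ s, e x = 0) (hf : ∀ x ∈ s, f x = 0) (hδ : 0 ≤ δ) :
    ∃ c > 0, ∀ x, τ x ≤ T → timerWeightedForm P Q δ e f τ x ≤ c * Metric.infDist x s ^ 2 := by
  refine ⟨‖P‖ * ‖e‖ ^ 2 + Real.exp (δ * T) * (‖Q‖ * ‖f‖ ^ 2) + 1, by positivity, fun x hx => ?_⟩
  have heP : P.reApplyInnerSelf (e x) ≤ ‖P‖ * (‖e‖ * Metric.infDist x s) ^ 2 :=
    (reApplyInnerSelf_le P _).trans (by gcongr; exact norm_map_le_mul_infDist hs he x)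
  have hfQ : Q.reApplyInnerSelf (f x) ≤ ‖Q‖ * (‖f‖ * Metric.infDist x s) ^ 2 :=
    (reApplyInnerSelf_le Q _).trans (by gcongr; exact norm_map_le_mul_infDist hs hf x)
  calc timerWeightedForm P Q δ e f τ x
      ≤ ‖P‖ * (‖e‖ * Metric.infDist x s) ^ 2
        + Real.exp (δ * τ x) * (‖Q‖ * (‖f‖ * Metric.infDist x s) ^ 2) := by
        unfold timerWeightedForm; gcongr
    _ ≤ ‖P‖ * (‖e‖ * Metric.infDist x s) ^ 2
        + Real.exp (δ * T) * (‖Q‖ * (‖f‖ * Metric.infDist x s) ^ 2) := by gcongr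
    _ ≤ _ := by linarith [sq_nonneg (Metric.infDist x s)]

end WeightedForm

section Matrix

variable {m n : ℕ}

/-- The action of a matrix on Euclidean vectors, as a continuous linear map. -/
def actCLM (M : Matrix (Fin m) (Fin n) ℝ) : Vec n →L[ℝ] Vec m :=
  (Matrix.toEuclideanLin M).toContinuousLinearMap

theorem inner_eq_dotProduct (x y : Vec n) : inner ℝ x y = x.ofLp ⬝ᵥ y.ofLp := by
  rw [EuclideanSpace.inner_eq_star_dotProduct, star_trivial, dotProduct_comm]

open Matrix in
theorem dotProduct_transpose_mulVec_left (M : Matrix (Fin m) (Fin n) ℝ) (x : Fin n → ℝ)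
    (y : Fin m → ℝ) : x ⬝ᵥ Mᵀ *ᵥ y = M *ᵥ x ⬝ᵥ y := by
  rw [dotProduct_mulVec, vecMul_transpose]

open Matrix in
theorem dotProduct_mulVec_nonpos {ι : Type*} [Fintype ι] {M : Matrix ι ι ℝ}
    (hM : (-M).PosSemidef) (v : ι → ℝ) : v ⬝ᵥ M *ᵥ v ≤ 0 := by
  simpa [neg_mulVec] using hM.dotProduct_mulVec_nonneg v

theorem isSymmetric_actCLM {P : Matrix (Fin n) (Fin n) ℝ} (hP : P.PosDef) :
    (actCLM P : Vec n →ₗ[ℝ] Vec n).IsSymmetric :=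
  Matrix.isSymmetric_toEuclideanLin_iff.mpr hP.isHermitian

theorem reApplyInnerSelf_actCLM_pos {P : Matrix (Fin n) (Fin n) ℝ} (hP : P.PosDef) :
    ∀ v ≠ 0, 0 < (actCLM P).reApplyInnerSelf v := by
  intro v hv
  have hpos := hP.dotProduct_mulVec_pos (x := v.ofLp) (by simpa using hv)
  rw [star_trivial, dotProduct_comm] at hpos
  exact hpos.trans_eq (inner_eq_dotProduct (P.act v) v).symm

theorem reApplyInnerSelf_actCLM_nonneg {P : Matrix (Fin n) (Fin n) ℝ} (hP : P.PosDef) (v : Vec n) :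
    0 ≤ (actCLM P).reApplyInnerSelf v := by
  rcases eq_or_ne v 0 with rfl | hv
  · rw [ContinuousLinearMap.reApplyInnerSelf_apply, map_zero, inner_zero_left, map_zero]
  · exact (reApplyInnerSelf_actCLM_pos hP v hv).le

end Matrix

/-! ### The matrix inequality -/

theorem add_mul_nonpos_of_mem_Icc {a b q r s : ℝ} (hq : a + q * b ≤ 0) (hr : a + r * b ≤ 0)
    (hs : s ∈ Icc q r) : a + s * b ≤ 0 := by
  rcases le_total 0 b with hb | hb
  · exact (by gcongr; exact hs.2 : a + s * b ≤ a + r * b).trans hr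
  · exact (add_le_add_right (mul_le_mul_of_nonpos_right hs.1 hb) a).trans hq

namespace PlantData

variable {nz ny nw nq ns np : ℕ} (p : PlantData nz ny nw nq ns np)

/-- The error dynamics `ε' = A ε + B ζ + N w - L (C ε - θ̃)`, with `ζ` in the place of
`ψ(S z) - ψ(S ẑ)`. -/
def errRate (L : Matrix (Fin nz) (Fin ny) ℝ) (ε : Vec nz) (η : Vec ny) (w : Vec nw) (ζ : Vec ns) :
    Vec nz :=
  p.A.act ε + p.B.act ζ + p.N.act w - L.act (p.C.act ε - η)

/-- The dynamics `θ̃' = C ε' - H (C ε - θ̃)` of the output error between the samples. -/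
def outErrRate (L : Matrix (Fin nz) (Fin ny) ℝ) (H : Matrix (Fin ny) (Fin ny) ℝ) (ε : Vec nz)
    (η : Vec ny) (w : Vec nw) (ζ : Vec ns) : Vec ny :=
  p.C.act (p.errRate L ε η w ζ) - H.act (p.C.act ε - η)

open Matrix in
theorem dotProduct_lmiMatrix_mulVec {P₁ : Matrix (Fin nz) (Fin nz) ℝ}
    {P₂ : Matrix (Fin ny) (Fin ny) ℝ} (hP₁ : P₁.IsSymm) (hP₂ : P₂.IsSymm)
    (L : Matrix (Fin nz) (Fin ny) ℝ) (H : Matrix (Fin ny) (Fin ny) ℝ) (ℓ lam γ δ χ s : ℝ)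
    (ε : Vec nz) (η : Vec ny) (w : Vec nw) (ζ : Vec ns) :
    Sum.elim (Sum.elim ε.ofLp η.ofLp) (Sum.elim w.ofLp ζ.ofLp) ⬝ᵥ
        p.lmiMatrix ℓ lam γ δ χ s P₁ P₂ (P₁ * L) ((H + p.C * L)ᵀ * P₂) *ᵥ
          Sum.elim (Sum.elim ε.ofLp η.ofLp) (Sum.elim w.ofLp ζ.ofLp) =
      2 * inner ℝ (P₁.act ε) (p.errRate L ε η w ζ) + 2 * lam * inner ℝ (P₁.act ε) ε
        + ‖p.Cp.act ε‖ ^ 2 + χ * (ℓ ^ 2 * ‖p.S.act ε‖ ^ 2 - ‖ζ‖ ^ 2) - γ ^ 2 * ‖w‖ ^ 2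
        + s * (2 * inner ℝ (P₂.act η) (p.outErrRate L H ε η w ζ)
          + (2 * lam - δ) * inner ℝ (P₂.act η) η) := by
  have hε : ∀ v, ε.ofLp ⬝ᵥ P₁ *ᵥ v = P₁ *ᵥ ε.ofLp ⬝ᵥ v := fun v => by
    rw [← dotProduct_transpose_mulVec_left, hP₁.eq]
  have hη : ∀ v, η.ofLp ⬝ᵥ P₂ *ᵥ v = P₂ *ᵥ η.ofLp ⬝ᵥ v := fun v => by
    rw [← dotProduct_transpose_mulVec_left, hP₂.eq]
  simp only [errRate, outErrRate, ← real_inner_self_eq_norm_sq, inner_eq_dotProduct, lmiMatrix,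
    Matrix.act, Matrix.ofLp_toLpLin, toLin'_apply, WithLp.ofLp_add, WithLp.ofLp_sub,
    fromBlocks_mulVec, Sum.elim_comp_inl, Sum.elim_comp_inr,
    dotProduct_add, sumElim_dotProduct_sumElim, fromBlocks_transpose,
    Matrix.add_mulVec, Matrix.sub_mulVec, Matrix.smul_mulVec, transpose_add, transpose_sub,
    transpose_mul, transpose_smul, ← mulVec_mulVec, dotProduct_transpose_mulVec_left, mulVec_add,
    mulVec_sub, dotProduct_sub, dotProduct_smul, transpose_transpose, Matrix.one_mulVec,
    Matrix.zero_mulVec, dotProduct_zero, hP₁.eq, hP₂.eq, smul_eq_mul, hε, hη]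
  simp only [dotProduct_comm]
  ring

variable {L : Matrix (Fin nz) (Fin ny) ℝ} {H : Matrix (Fin ny) (Fin ny) ℝ} {ℓ lam γ δ χ : ℝ}
  {P₁ : Matrix (Fin nz) (Fin nz) ℝ} {P₂ : Matrix (Fin ny) (Fin ny) ℝ}

open Matrix in
theorem errRate_dissipation {s r : ℝ} (hP₁ : P₁.PosDef) (hP₂ : P₂.PosDef) (hχ : 0 ≤ χ)
    (h₁ : (-p.lmiMatrix ℓ lam γ δ χ 1 P₁ P₂ (P₁ * L) ((H + p.C * L)ᵀ * P₂)).PosSemidef)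
    (hr : (-p.lmiMatrix ℓ lam γ δ χ r P₁ P₂ (P₁ * L) ((H + p.C * L)ᵀ * P₂)).PosSemidef)
    (hs : s ∈ Icc 1 r) {ε : Vec nz} {ζ : Vec ns} (hζ : ‖ζ‖ ≤ ℓ * ‖p.S.act ε‖) (η : Vec ny)
    (w : Vec nw) :
    2 * inner ℝ (P₁.act ε) (p.errRate L ε η w ζ)
        + s * (2 * inner ℝ (P₂.act η) (p.outErrRate L H ε η w ζ) - δ * inner ℝ (P₂.act η) η)
        + 2 * lam * (inner ℝ (P₁.act ε) ε + s * inner ℝ (P₂.act η) η) + ‖p.Cp.act ε‖ ^ 2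
      ≤ γ ^ 2 * ‖w‖ ^ 2 := by
  have hform₁ := dotProduct_mulVec_nonpos h₁
    (Sum.elim (Sum.elim ε.ofLp η.ofLp) (Sum.elim w.ofLp ζ.ofLp))
  have hformᵣ := dotProduct_mulVec_nonpos hr
    (Sum.elim (Sum.elim ε.ofLp η.ofLp) (Sum.elim w.ofLp ζ.ofLp))
  rw [p.dotProduct_lmiMatrix_mulVec (isHermitian_iff_isSymm.mp hP₁.isHermitian)
    (isHermitian_iff_isSymm.mp hP₂.isHermitian)] at hform₁ hformᵣ
  have hsector : 0 ≤ χ * (ℓ ^ 2 * ‖p.S.act ε‖ ^ 2 - ‖ζ‖ ^ 2) := by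
    rw [← mul_pow]
    exact mul_nonneg hχ (sub_nonneg.mpr (by gcongr))
  have := add_mul_nonpos_of_mem_Icc hform₁ hformᵣ hs
  linarith

end PlantData

/-! ### The interconnection with the observer -/

namespace ObsState

variable {nz ny : ℕ}

/-- The coordinate `z` of the state, as a continuous linear map. -/
def zL : ObsState nz ny →L[ℝ] Vec nz := WithLp.fstL 2 ℝ _ _

/-- The coordinate `ẑ` of the state, as a continuous linear map. -/
def zhatL : ObsState nz ny →L[ℝ] Vec nz := (WithLp.fstL 2 ℝ _ _).comp (WithLp.sndL 2 ℝ _ _)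

/-- The coordinate `θ` of the state, as a continuous linear map. -/
def θL : ObsState nz ny →L[ℝ] Vec ny :=
  ((WithLp.fstL 2 ℝ _ _).comp (WithLp.sndL 2 ℝ _ _)).comp (WithLp.sndL 2 ℝ _ _)

/-- The timer `τ`, as a continuous linear map. -/
def τL : ObsState nz ny →L[ℝ] ℝ :=
  ((WithLp.sndL 2 ℝ _ _).comp (WithLp.sndL 2 ℝ _ _)).comp (WithLp.sndL 2 ℝ _ _)

/-- The estimation error `ε = z - ẑ`. -/
def err : ObsState nz ny →L[ℝ] Vec nz := zL - zhatL

theorem norm_mk_sq (z zhat : Vec nz) (θ : Vec ny) (τ : ℝ) :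
    ‖mk z zhat θ τ‖ ^ 2 = ‖z‖ ^ 2 + (‖zhat‖ ^ 2 + (‖θ‖ ^ 2 + ‖τ‖ ^ 2)) := by
  simp only [mk, WithLp.prod_norm_sq_eq_of_L2, WithLp.toLp_fst, WithLp.toLp_snd]

end ObsState

namespace PlantData

variable {nz ny nw nq ns np : ℕ} (p : PlantData nz ny nw nq ns np)

/-- The output error `θ̃ = C ε - θ`. -/
def outErr : ObsState nz ny →L[ℝ] Vec ny := (actCLM p.C).comp ObsState.err - ObsState.θL

/-- The Lyapunov function `⟪P₁ ε, ε⟫ + exp (δ τ) ⟪P₂ θ̃, θ̃⟫` of the observer. -/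
def lyap (P₁ : Matrix (Fin nz) (Fin nz) ℝ) (P₂ : Matrix (Fin ny) (Fin ny) ℝ) (δ : ℝ) :
    ObsState nz ny → ℝ :=
  timerWeightedForm (actCLM P₁) (actCLM P₂) δ ObsState.err p.outErr ObsState.τL

variable {p} {L : Matrix (Fin nz) (Fin ny) ℝ} {H : Matrix (Fin ny) (Fin ny) ℝ}
  {ℓ : NNReal} {lam γ δ χ T₁ T₂ : ℝ}
  {P₁ : Matrix (Fin nz) (Fin nz) ℝ} {P₂ : Matrix (Fin ny) (Fin ny) ℝ}

theorem isTimer_withObserver (hT₁ : 0 < T₁) (hT₁₂ : T₁ ≤ T₂) :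
    (p.withObserver T₁ T₂ L H).IsTimer ObsState.τL T₁ T₂ where
  pos := hT₁
  le := hT₁₂
  flowSet_eq := rfl
  jumpSet_eq := rfl
  map_flowMap _ _ := rfl
  map_jumpMap := by
    rintro x η _ ⟨v, hv, rfl⟩
    exact hv

theorem nonempty_jumpMap_withObserver (hT₁₂ : T₁ ≤ T₂) (x : ObsState nz ny) (η : Vec ny) :
    ((p.withObserver T₁ T₂ L H).jumpMap x η).Nonempty :=
  ⟨_, T₁, left_mem_Icc.mpr hT₁₂, rfl⟩

theorem lipschitzWith_drift (hψ : LipschitzWith ℓ p.ψ) :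
    LipschitzWith (‖actCLM p.A‖₊ + ‖actCLM p.B‖₊ * (ℓ * ‖actCLM p.S‖₊)) p.drift :=
  (actCLM p.A).lipschitz.add ((actCLM p.B).lipschitz.comp (hψ.comp (actCLM p.S).lipschitz))

theorem exists_lipschitzWith_flowMap_withObserver (hψ : LipschitzWith ℓ p.ψ) :
    ∃ C, LipschitzWith C (Function.uncurry (p.withObserver T₁ T₂ L H).flowMap) := by
  have hz := ObsState.zL.lipschitz.comp
    (LipschitzWith.prod_fst (α := ObsState nz ny) (β := Vec nw))
  have hzhat := ObsState.zhatL.lipschitz.comp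
    (LipschitzWith.prod_fst (α := ObsState nz ny) (β := Vec nw))
  have hθ := ObsState.θL.lipschitz.comp
    (LipschitzWith.prod_fst (α := ObsState nz ny) (β := Vec nw))
  have hw := LipschitzWith.prod_snd (α := ObsState nz ny) (β := Vec nw)
  have hdrift := lipschitzWith_drift hψ
  have hflow₁ := (hdrift.comp hz).add ((actCLM p.N).lipschitz.comp hw)
  have hflow₂ := (hdrift.comp hzhat).add ((actCLM L).lipschitz.comp hθ)
  have hflow₃ := (actCLM H).lipschitz.comp hθ
  exact ⟨_, (WithLp.prod_lipschitzWith_toLp 2 _ _).comp (hflow₁.prodMk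
    ((WithLp.prod_lipschitzWith_toLp 2 _ _).comp (hflow₂.prodMk
      ((WithLp.prod_lipschitzWith_toLp 2 _ _).comp (hflow₃.prodMk (LipschitzWith.const (-1)))))))⟩

theorem target_nonempty (hT₂ : 0 ≤ T₂) : (p.target T₂).Nonempty :=
  ⟨0, sub_self _, p.outErr.map_zero, left_mem_Icc.mpr hT₂⟩

theorem exists_infDist_target_sq_le (p : PlantData nz ny nw nq ns np) :
    ∃ c > 0, ∀ x : ObsState nz ny, x.τ ∈ Icc 0 T₂ →
      Metric.infDist x (p.target T₂) ^ 2 ≤ c * (‖x.err‖ ^ 2 + ‖p.outErr x‖ ^ 2) := by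
  refine ⟨2 * ‖actCLM p.C‖ ^ 2 + 2, by positivity, fun x hx => ?_⟩
  have hmem : ObsState.mk x.z x.z 0 x.τ ∈ p.target T₂ :=
    ⟨sub_self _, by simp [ObsState.mk, ObsState.z, ObsState.zhat, ObsState.θ], hx⟩
  have hdist : ‖x - ObsState.mk x.z x.z 0 x.τ‖ ^ 2 = ‖x.err‖ ^ 2 + ‖x.θ‖ ^ 2 := by
    have hsub : x - ObsState.mk x.z x.z 0 x.τ =
      ObsState.mk (x.z - x.z) (x.zhat - x.z) (x.θ - 0) (x.τ - x.τ) := rfl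
    rw [hsub, ObsState.norm_mk_sq, norm_sub_rev x.zhat]
    simp [ObsState.err, ObsState.z, ObsState.zhat, ObsState.zL, ObsState.zhatL]
  have hθ : x.θ = actCLM p.C x.err - p.outErr x := (sub_sub_cancel _ _).symm
  have hθ_sq : ‖x.θ‖ ^ 2 ≤ 2 * (‖actCLM p.C‖ ^ 2 * ‖x.err‖ ^ 2 + ‖p.outErr x‖ ^ 2) :=
    calc ‖x.θ‖ ^ 2 ≤ (‖actCLM p.C‖ * ‖x.err‖ + ‖p.outErr x‖) ^ 2 := by
          rw [hθ]
          gcongr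
          exact (norm_sub_le _ _).trans (by gcongr; exact (actCLM p.C).le_opNorm _)
      _ ≤ 2 * ((‖actCLM p.C‖ * ‖x.err‖) ^ 2 + ‖p.outErr x‖ ^ 2) := add_sq_le
      _ = _ := by rw [mul_pow]
  calc Metric.infDist x (p.target T₂) ^ 2 ≤ ‖x - ObsState.mk x.z x.z 0 x.τ‖ ^ 2 := by
        rw [← dist_eq_norm]
        gcongr
        exacts [Metric.infDist_nonneg, Metric.infDist_le_dist_of_mem hmem]
    _ ≤ (1 + 2 * ‖actCLM p.C‖ ^ 2) * ‖x.err‖ ^ 2 + 2 * ‖p.outErr x‖ ^ 2 := by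
        rw [hdist]; linarith
    _ ≤ (2 * ‖actCLM p.C‖ ^ 2 + 2) * (‖x.err‖ ^ 2 + ‖p.outErr x‖ ^ 2) := by
        have : 0 ≤ ‖x.err‖ ^ 2 + 2 * ‖actCLM p.C‖ ^ 2 * ‖p.outErr x‖ ^ 2 := by positivity
        linarith

theorem err_flowMap_withObserver (x : ObsState nz ny) (w : Vec nw) :
    ((p.withObserver T₁ T₂ L H).flowMap x w).err =
      p.errRate L x.err (p.outErr x) w (p.ψ (p.S.act x.z) - p.ψ (p.S.act x.zhat)) := by
  have hθ : p.C.act x.err - p.outErr x = x.θ := sub_sub_cancel _ _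
  have hA : p.A.act x.err = p.A.act x.z - p.A.act x.zhat := map_sub (actCLM p.A) _ _
  have hB : p.B.act (p.ψ (p.S.act x.z) - p.ψ (p.S.act x.zhat)) =
      p.B.act (p.ψ (p.S.act x.z)) - p.B.act (p.ψ (p.S.act x.zhat)) := map_sub (actCLM p.B) _ _
  rw [errRate, hθ, hA, hB]
  change p.drift x.z + p.N.act w - (p.drift x.zhat + L.act x.θ) = _
  rw [drift, drift]
  abel

theorem outErr_flowMap_withObserver (x : ObsState nz ny) (w : Vec nw) :
    p.outErr ((p.withObserver T₁ T₂ L H).flowMap x w) =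
      p.outErrRate L H x.err (p.outErr x) w (p.ψ (p.S.act x.z) - p.ψ (p.S.act x.zhat)) := by
  have hθ : p.C.act x.err - p.outErr x = x.θ := sub_sub_cancel _ _
  rw [outErrRate, ← err_flowMap_withObserver (T₁ := T₁) (T₂ := T₂) (H := H), hθ]
  rfl

theorem fderiv_lyap_flowMap_le (hψ : LipschitzWith ℓ p.ψ) (hP₁ : P₁.PosDef) (hP₂ : P₂.PosDef)
    (hδ : 0 ≤ δ) (hχ : 0 ≤ χ)
    (hLMI₀ : (-p.lmiMatrix ℓ lam γ δ χ 1 P₁ P₂ (P₁ * L)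
      ((H + p.C * L).transpose * P₂)).PosSemidef)
    (hLMI₂ : (-p.lmiMatrix ℓ lam γ δ χ (Real.exp (δ * T₂)) P₁ P₂ (P₁ * L)
      ((H + p.C * L).transpose * P₂)).PosSemidef)
    {x : ObsState nz ny} (hx : x.τ ∈ Icc 0 T₂) (w : Vec nw) :
    fderiv ℝ (p.lyap P₁ P₂ δ) x ((p.withObserver T₁ T₂ L H).flowMap x w)
      + 2 * lam * p.lyap P₁ P₂ δ x + ‖p.perfOutput x‖ ^ 2 ≤ γ ^ 2 * ‖w‖ ^ 2 := by
  have hweight : Real.exp (δ * x.τ) ∈ Icc 1 (Real.exp (δ * T₂)) :=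
    ⟨Real.one_le_exp (mul_nonneg hδ hx.1), by gcongr; exact hx.2⟩
  have hζ : ‖p.ψ (p.S.act x.z) - p.ψ (p.S.act x.zhat)‖ ≤ ℓ * ‖p.S.act x.err‖ :=
    (hψ.norm_sub_le _ _).trans_eq (by rw [← map_sub]; rfl)
  have hτ : ObsState.τL ((p.withObserver T₁ T₂ L H).flowMap x w) = -1 := rfl
  rw [lyap, fderiv_timerWeightedForm (isSymmetric_actCLM hP₁) (isSymmetric_actCLM hP₂),
    err_flowMap_withObserver, outErr_flowMap_withObserver, hτ, mul_neg_one, neg_mul,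
    ← sub_eq_add_neg]
  exact p.errRate_dissipation hP₁ hP₂ hχ hLMI₀ hLMI₂ hweight hζ (p.outErr x) w

/-- A sample leaves `ε` alone and resets `θ̃` to `-η`. -/
theorem lyap_le_of_mem_jumpMap (hP₂ : P₂.PosDef) (hδ : 0 ≤ δ) {x x' : ObsState nz ny} {η : Vec ny}
    (hx' : x' ∈ (p.withObserver T₁ T₂ L H).jumpMap x η) :
    p.lyap P₁ P₂ δ x' ≤
      p.lyap P₁ P₂ δ x + Real.exp (δ * T₂) * ‖actCLM P₂‖ * ‖η‖ ^ 2 := by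
  obtain ⟨v, hv, rfl⟩ := hx'
  have hη : p.outErr (ObsState.mk x.z x.zhat (p.C.act x.z + η - p.C.act x.zhat) v) = -η :=
    calc _ = p.C.act (x.z - x.zhat) - (p.C.act x.z + η - p.C.act x.zhat) := rfl
      _ = -η := by rw [Matrix.act, map_sub]; abel
  have hreset : (actCLM P₂).reApplyInnerSelf (-η) ≤ ‖actCLM P₂‖ * ‖η‖ ^ 2 := by
    simpa only [norm_neg] using reApplyInnerSelf_le (actCLM P₂) (-η)
  have hQ := reApplyInnerSelf_actCLM_nonneg hP₂
  calc _ = (actCLM P₁).reApplyInnerSelf x.err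
          + Real.exp (δ * v) * (actCLM P₂).reApplyInnerSelf (-η) := by rw [← hη]; rfl
    _ ≤ p.lyap P₁ P₂ δ x + Real.exp (δ * T₂) * (‖actCLM P₂‖ * ‖η‖ ^ 2) := by
        gcongr
        · exact le_add_of_nonneg_right (mul_nonneg (Real.exp_pos _).le (hQ _))
        · exact hQ _
        · exact hv.2
    _ = _ := by rw [mul_assoc]

theorem isStorage_lyap (hψ : LipschitzWith ℓ p.ψ) (hP₁ : P₁.PosDef) (hP₂ : P₂.PosDef)
    (hδ : 0 ≤ δ) (hχ : 0 ≤ χ) (hT₂ : 0 ≤ T₂)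
    (hLMI₀ : (-p.lmiMatrix ℓ lam γ δ χ 1 P₁ P₂ (P₁ * L)
      ((H + p.C * L).transpose * P₂)).PosSemidef)
    (hLMI₂ : (-p.lmiMatrix ℓ lam γ δ χ (Real.exp (δ * T₂)) P₁ P₂ (P₁ * L)
      ((H + p.C * L).transpose * P₂)).PosSemidef) :
    (p.withObserver T₁ T₂ L H).IsStorage (p.target T₂) p.perfOutput (2 * lam) γ
      (p.lyap P₁ P₂ δ) where
  contDiff := contDiff_timerWeightedForm
  nonneg := timerWeightedForm_nonneg (reApplyInnerSelf_actCLM_nonneg hP₁)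
    (reApplyInnerSelf_actCLM_nonneg hP₂)
  flow _ hx := fderiv_lyap_flowMap_le hψ hP₁ hP₂ hδ hχ hLMI₀ hLMI₂ hx
  exists_jump_le := ⟨Real.exp (δ * T₂) * ‖actCLM P₂‖, by positivity,
    fun _ _ _ => lyap_le_of_mem_jumpMap hP₂ hδ⟩
  exists_infDist_sq_le := by
    obtain ⟨c, hc, hdist⟩ := p.exists_infDist_target_sq_le (T₂ := T₂)
    obtain ⟨K, hK, hform⟩ := exists_norm_sq_add_norm_sq_le_timerWeightedForm
      (e := ObsState.err) (f := p.outErr) (τ := ObsState.τL)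
      (reApplyInnerSelf_actCLM_pos hP₁) (reApplyInnerSelf_actCLM_pos hP₂) hδ
    refine ⟨c * K, by positivity, fun x hx => (hdist x hx).trans ?_⟩
    rw [mul_assoc]
    gcongr
    exact hform x hx.1
  exists_le_infDist_sq := by
    obtain ⟨c, hc, hform⟩ := exists_timerWeightedForm_le_infDist_sq (P := actCLM P₁)
      (Q := actCLM P₂) (T := T₂) (e := ObsState.err) (f := p.outErr) (τ := ObsState.τL)
      (target_nonempty (p := p) hT₂) (fun _ hx => hx.1) (fun _ hx => hx.2.1) hδ
    exact ⟨c, hc, fun x hx => hform x hx.2⟩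

theorem solvesObserverProblem_of_posSemidef (hψ : LipschitzWith ℓ p.ψ) (hT₁ : 0 < T₁)
    (hT₁₂ : T₁ ≤ T₂) (hlam : 0 < lam) (hγ : 0 ≤ γ) (hP₁ : P₁.PosDef) (hP₂ : P₂.PosDef)
    (hδ : 0 ≤ δ) (hχ : 0 ≤ χ)
    (hLMI₀ : (-p.lmiMatrix ℓ lam γ δ χ 1 P₁ P₂ (P₁ * L)
      ((H + p.C * L).transpose * P₂)).PosSemidef)
    (hLMI₂ : (-p.lmiMatrix ℓ lam γ δ χ (Real.exp (δ * T₂)) P₁ P₂ (P₁ * L)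
      ((H + p.C * L).transpose * P₂)).PosSemidef) :
    p.SolvesObserverProblem T₁ T₂ lam γ L H := by
  have hV := isStorage_lyap (T₁ := T₁) hψ hP₁ hP₂ hδ hχ (hT₁.le.trans hT₁₂) hLMI₀ hLMI₂
  have hτ : (p.withObserver T₁ T₂ L H).IsTimer ObsState.τL T₁ T₂ := isTimer_withObserver hT₁ hT₁₂
  have hjump : ∀ x η, ((p.withObserver T₁ T₂ L H).jumpMap x η).Nonempty :=
    nonempty_jumpMap_withObserver hT₁₂
  obtain ⟨K, hflow⟩ :
      ∃ K, LipschitzWith K (Function.uncurry (p.withObserver T₁ T₂ L H).flowMap) :=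
    exists_lipschitzWith_flowMap_withObserver hψ
  exact ⟨hV.isGloballyExpStable hτ hlam hflow hjump, hV.isExpISS hτ hlam hflow hjump,
    hV.isL2Stable hτ (by positivity) hγ⟩

end PlantData

/-! ### The predictor-based observer -/

namespace HybridSystem

variable {X Y W N : Type*} [NormedAddCommGroup X] [NormedSpace ℝ X] [NormedAddCommGroup Y]
  [NormedSpace ℝ Y] [NormedAddCommGroup W] [MeasurableSpace W] [NormedAddCommGroup N]
  [MeasurableSpace N] {S : HybridSystem X W N} {S' : HybridSystem Y W N} {φ : HybridSignal X}
  {u : HybridSignal (InputPair W N)}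

theorem IsSolutionPair.map (h : S.IsSolutionPair φ u) (f : X →L[ℝ] Y)
    (hflowSet : ∀ x ∈ S.flowSet, f x ∈ S'.flowSet) (hjumpSet : ∀ x ∈ S.jumpSet, f x ∈ S'.jumpSet)
    (hflowMap : ∀ x w, f (S.flowMap x w) = S'.flowMap (f x) w)
    (hjumpMap : ∀ x η, ∀ x' ∈ S.jumpMap x η, f x' ∈ S'.jumpMap (f x) η) :
    S'.IsSolutionPair (φ.map f) u where
  arc j a b hab hj := absolutelyContinuousOnInterval_comp_contDiff (h.arc j a b hab hj) f.contDiff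
  input := h.input
  dom_eq := h.dom_eq
  init := h.init.imp (fun h₀ => (map_mem_closure f.continuous h₀ hflowSet : f _ ∈ _)) (hjumpSet _)
  flow_mem j t ht := hflowSet _ (h.flow_mem j t ht)
  flow j := by
    change ∀ᵐ t ∂(volume.restrict (φ.slice j)), _
    filter_upwards [h.flow j] with t ht
    exact (f.hasFDerivAt.comp_hasDerivAt t ht).congr_deriv (hflowMap _ _)
  jump t j ht ht' := (h.jump t j ht ht').imp (hjumpSet _) (hjumpMap _ _ _)

theorem isSolutionPair_map_iff (f : X ≃L[ℝ] Y)
    (hflowSet : ∀ x, f x ∈ S'.flowSet ↔ x ∈ S.flowSet)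
    (hjumpSet : ∀ x, f x ∈ S'.jumpSet ↔ x ∈ S.jumpSet)
    (hflowMap : ∀ x w, f (S.flowMap x w) = S'.flowMap (f x) w)
    (hjumpMap : ∀ x η x', f x' ∈ S'.jumpMap (f x) η ↔ x' ∈ S.jumpMap x η) :
    S'.IsSolutionPair (φ.map f) u ↔ S.IsSolutionPair φ u := by
  refine ⟨fun h => ?_, fun h => h.map (f : X →L[ℝ] Y) (fun x => (hflowSet x).2)
    (fun x => (hjumpSet x).2) hflowMap fun x η x' => (hjumpMap x η x').2⟩
  have hinv : (φ.map f).map f.symm = φ := by simp [HybridSignal.map]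
  rw [← hinv]
  refine h.map (f.symm : Y →L[ℝ] X) (fun y hy => ?_) (fun y hy => ?_) (fun y w => ?_)
    fun y η y' hy' => ?_
  · exact (hflowSet _).1 (by simpa using hy)
  · exact (hjumpSet _).1 (by simpa using hy)
  · exact f.injective (by simp [hflowMap])
  · exact (hjumpMap _ _ _).1 (by simpa using hy')

end HybridSystem

namespace ObsState

-- A shortcut: the general search for this instance is slow.
instance continuousSMul {nz ny : ℕ} : ContinuousSMul ℝ (ObsState nz ny) :=
  IsBoundedSMul.continuousSMul

end ObsState

namespace PlantData

variable {nz ny nw nq ns np : ℕ} (p : PlantData nz ny nw nq ns np)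

/-- `predictorCoord` as a continuous linear equivalence; its inverse subtracts `C ẑ`. -/
def predictorEquiv : ObsState nz ny ≃L[ℝ] ObsState nz ny :=
  LinearEquiv.toContinuousLinearEquiv
    { toFun := p.predictorCoord
      invFun := fun x => ObsState.mk x.z x.zhat (x.θ - p.C.act x.zhat) x.τ
      map_add' := fun x y => by
        change ObsState.mk _ _ (x.θ + y.θ + actCLM p.C (x.zhat + y.zhat)) _ =
          ObsState.mk _ _ (x.θ + p.C.act x.zhat + (y.θ + p.C.act y.zhat)) _
        rw [map_add, add_add_add_comm]
        rfl
      map_smul' := fun c x => by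
        change ObsState.mk _ _ (c • x.θ + actCLM p.C (c • x.zhat)) _ =
          ObsState.mk _ _ (c • (x.θ + p.C.act x.zhat)) _
        rw [map_smul, smul_add]
        rfl
      left_inv := fun x =>
        congrArg (ObsState.mk x.z x.zhat · x.τ) (add_sub_cancel_right x.θ (p.C.act x.zhat))
      right_inv := fun x =>
        congrArg (ObsState.mk x.z x.zhat · x.τ) (sub_add_cancel x.θ (p.C.act x.zhat)) }

theorem isSolutionPair_withPredictor_iff {T₁ T₂ : ℝ} {L : Matrix (Fin nz) (Fin ny) ℝ}
    {φ : HybridSignal (ObsState nz ny)} {u : HybridSignal (InputPair (Vec nw) (Vec ny))} :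
    (p.withPredictor T₁ T₂ L).IsSolutionPair (φ.map p.predictorCoord) u ↔
      (p.withObserver T₁ T₂ L (-(p.C * L))).IsSolutionPair φ u := by
  refine HybridSystem.isSolutionPair_map_iff p.predictorEquiv (fun x => Iff.rfl)
    (fun x => Iff.rfl) (fun x w => ?_) fun x η x' => ?_
  · have hgain : (-(p.C * L)).act x.θ = -p.C.act (L.act x.θ) := by
      simp [Matrix.act, Matrix.toLpLin_mul_same]
    change ObsState.mk _ _ ((-(p.C * L)).act x.θ + actCLM p.C (p.drift x.zhat + L.act x.θ)) _ =
      ObsState.mk _ (p.drift x.zhat + L.act (x.θ + p.C.act x.zhat - p.C.act x.zhat)) _ _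
    rw [add_sub_cancel_right, hgain, map_add, neg_add_eq_sub]
    exact congrArg (ObsState.mk _ _ · _) (add_sub_cancel_right _ _)
  · refine exists_congr fun v => and_congr_right fun _ => ?_
    rw [← p.predictorEquiv.injective.eq_iff (a := x')]
    change _ ↔ _ = ObsState.mk _ _ (p.C.act x.z + η - p.C.act x.zhat + p.C.act x.zhat) _
    rw [sub_add_cancel]
    rfl

end PlantData

end

theorem proposition2 {nz ny nw nq ns np : ℕ} (p : PlantData nz ny nw nq ns np)
    (ℓ : ℝ) (hℓ : 0 < ℓ) (hψ : ∀ v₁ v₂ : Vec nq, ‖p.ψ v₁ - p.ψ v₂‖ ≤ ℓ * ‖v₁ - v₂‖)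
    (T₁ T₂ : ℝ) (hT₁ : 0 < T₁) (hT₁₂ : T₁ ≤ T₂)
    (lam γ : ℝ) (hlam : 0 < lam) (hγ : 0 < γ)
    (P₁ : Matrix (Fin nz) (Fin nz) ℝ) (hP₁ : P₁.PosDef)
    (P₂ : Matrix (Fin ny) (Fin ny) ℝ) (hP₂ : P₂.PosDef)
    (δ χ : ℝ) (hδ : 0 < δ) (hχ : 0 < χ)
    (J : Matrix (Fin nz) (Fin ny) ℝ) (Y : Matrix (Fin ny) (Fin ny) ℝ)
    (hLMI₀ : (-p.lmiMatrix ℓ lam γ δ χ 1 P₁ P₂ J Y).PosSemidef)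
    (hLMI₂ : (-p.lmiMatrix ℓ lam γ δ χ (Real.exp (δ * T₂)) P₁ P₂ J Y).PosSemidef) :
    p.SolvesObserverProblem T₁ T₂ lam γ (P₁⁻¹ * J) (P₂⁻¹ * Y.transpose - p.C * (P₁⁻¹ * J)) ∧
    (Y = 0 → ∀ φ u,
      (p.withObserver T₁ T₂ (P₁⁻¹ * J)
          (P₂⁻¹ * Y.transpose - p.C * (P₁⁻¹ * J))).IsSolutionPair φ u ↔
        (p.withPredictor T₁ T₂ (P₁⁻¹ * J)).IsSolutionPair (φ.map p.predictorCoord) u) := by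
  lift ℓ to NNReal using hℓ.le
  have hJ : P₁ * (P₁⁻¹ * J) = J :=
    Matrix.mul_nonsing_inv_cancel_left _ _ ((Matrix.isUnit_iff_isUnit_det _).mp hP₁.isUnit)
  have hY : (P₂⁻¹ * Y.transpose - p.C * (P₁⁻¹ * J) + p.C * (P₁⁻¹ * J)).transpose * P₂ = Y := by
    rw [sub_add_cancel, Matrix.transpose_mul, Matrix.transpose_transpose,
      Matrix.isHermitian_iff_isSymm.mp hP₂.isHermitian.inv,
      Matrix.nonsing_inv_mul_cancel_right _ _ ((Matrix.isUnit_iff_isUnit_det _).mp hP₂.isUnit)]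
  have hLip : LipschitzWith ℓ p.ψ := lipschitzWith_iff_norm_sub_le.mpr hψ
  refine ⟨PlantData.solvesObserverProblem_of_posSemidef hLip hT₁ hT₁₂ hlam hγ.le hP₁ hP₂ hδ.le hχ.le
    (by rwa [hJ, hY]) (by rwa [hJ, hY]), ?_⟩
  rintro rfl φ u
  rw [Matrix.transpose_zero, Matrix.mul_zero, zero_sub]
  exact p.isSolutionPair_withPredictor_iff.symm
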